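/- Let $a\in(0,1)$ and $\theta\in[1,2)$, and put $\nu_\theta=\frac{\theta-1}{2-\theta}$, $k_\theta=\frac{2-\theta}{2}$. Let $J_{\nu}(z)=\sum_{k\ge 0}\frac{(-1)^k}{k!\,\Gamma(k+\nu+1)}\left(\frac z2\right)^{2k+\nu}$ $(z\ge 0)$ be the Bessel function of the first kind of order $\nu$. Let $H^1_\theta(0,1)$ be the space of functions $w\in L^2(0,1)$ (real- or complex-valued) that are locally absolutely continuous in $[0,a)$ and in $(a,1]$, with $\int_0^1|x-a|^\theta|w'(x)|^2\,dx<\infty$ and $w(0)=0=w(1)$, and let $H^2_\theta(0,1)$ be the space of those $w\in H^1_\theta(0,1)$ for which $|x-a|^\theta w'$ is locally absolutely continuous in $(0,a)$ and in $(a,1)$ with $\int_0^1|(|x-a|^\theta w')'|^2\,dx<\infty$. A number $\lambda$ is called an eigenvalue, with eigenfunction $\phi$, if $\phi\in H^2_\theta(0,1)$ is not almost everywhere zero and $$-(|x-a|^\theta\phi'(x))'=\lambda\,\phi(x)\quad\text{for a.e. }x\in(0,1),\qquad \phi(0)=0=\phi(1).$$ Then the positive zeros of $J_{\nu_\theta}$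 form a strictly increasing sequence $j_{\nu_\theta,1}<j_{\nu_\theta,2}<\cdots$; the set of eigenvalues (both over $\mathbb R$ and over $\mathbb C$) consists exactly of the numbers $$\lambda^{(r)}_n=k_\theta^2\,\frac{j_{\nu_\theta,n}^2}{(1-a)^{2k_\theta}},\qquad \lambda^{(l)}_n=k_\theta^2\,\frac{j_{\nu_\theta,n}^2}{a^{2k_\theta}}\qquad(n\ge1);$$ for every $n\ge 1$ the functions $$\tilde\phi^{(r)}_{\theta,n}(x)=\begin{cases}0,&x\in(0,a),\\ \dfrac{\sqrt{2k_\theta}}{\sqrt{1-a}\;|J_{\nu_\theta}'(j_{\nu_\theta,n})|}\left(\dfrac{x-a}{1-a}\right)^{\frac{1-\theta}2}J_{\nu_\theta}\!\left(j_{\nu_\theta,n}\left(\dfrac{x-a}{1-a}\right)^{k_\theta}\right),&x\in(a,1),\end{cases}$$ $$\tilde\phi^{(l)}_{\theta,n}(x)=\begin{cases}\dfrac{\sqrt{2k_\theta}}{\sqrt{a}\;|J_{\nu_\theta}'(j_{\nu_\theta,n})|}\left|\dfrac{x-a}{a}\right|^{\frac{1-\theta}2}J_{\nu_\theta}\!\left(j_{\nu_\theta,n}\left|\dfrac{x-a}{a}\right|^{k_\theta}\right),&x\in(0,a),\\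 0,&x\in(a,1),\end{cases}$$ are eigenfunctions for $\lambda^{(r)}_n$ and $\lambda^{(l)}_n$ respectively; and the family $\{\tilde\phi^{(r)}_{\theta,n}\}_{n\ge1}\cup\{\tilde\phi^{(l)}_{\theta,n}\}_{n\ge1}$ is an orthonormal basis of $L^2(0,1)$ (over $\mathbb R$ and over $\mathbb C$). -/

import Mathlib

open MeasureTheory Set

noncomputable section

/-- The Bessel function of the first kind of real order `ν`, by its series, for `z ≥ 0`. -/
def besselJ (ν z : ℝ) : ℝ :=
  ∑' k : ℕ, (-1 : ℝ) ^ k / ((k.factorial : ℝ) * Real.Gamma ((k : ℝ) + ν + 1)) *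
    (z / 2) ^ (2 * (k : ℝ) + ν)

/-- The positive zeros of `J_ν` in increasing order: `besselZero ν n` is the zero `j_{ν,n+1}`
(the numbering of the code starts at `0`). -/
def besselZero (ν : ℝ) : ℕ → ℝ
  | 0 => sInf {z : ℝ | 0 < z ∧ besselJ ν z = 0}
  | n + 1 => sInf {z : ℝ | besselZero ν n < z ∧ besselJ ν z = 0}

/-- The order `ν_θ = (θ - 1) / (2 - θ)`. -/
def degOrder (θ : ℝ) : ℝ := |θ - 1| / (2 - θ)

/-- The exponent `k_θ = (2 - θ) / 2`. -/
def degExp (θ : ℝ) : ℝ := (2 - θ) / 2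

/-- Lebesgue measure on the interval `(0,1)`. -/
abbrev unitMeasure : Measure ℝ := volume.restrict (Ioo (0 : ℝ) 1)

section Operator

variable {𝕜 : Type*} [RCLike 𝕜]

/-- The flux `x ↦ |x - a|^θ w'(x)`. -/
def degFlux (a θ : ℝ) (w : ℝ → 𝕜) (x : ℝ) : 𝕜 := (|x - a| ^ θ : ℝ) • deriv w x

/-- The operator `w ↦ (|x - a|^θ w')'`. -/
def degOp (a θ : ℝ) (w : ℝ → 𝕜) : ℝ → 𝕜 := deriv (degFlux a θ w)

/-- The weighted space `H¹_θ(0,1)` (for `1 ≤ θ < 2`): `w` is in `L²(0,1)`, locally absolutely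
continuous in `[0,a)` and in `(a,1]`, with `∫₀¹ |x - a|^θ |w'|² < ∞` and `w(0) = 0 = w(1)`.
Only the restriction of `w` to `[0,1]` matters. -/
structure MemH1 (a θ : ℝ) (w : ℝ → 𝕜) : Prop where
  memLp : MemLp w 2 unitMeasure
  ac_left : ∀ b ∈ Ico 0 a, AbsolutelyContinuousOnInterval w 0 b
  ac_right : ∀ b ∈ Ioc a 1, AbsolutelyContinuousOnInterval w b 1
  energy : Integrable (fun x => |x - a| ^ θ * ‖deriv w x‖ ^ 2) unitMeasure
  left_zero : w 0 = 0
  right_zero : w 1 = 0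

/-- The domain `H²_θ(0,1)` of the operator: those `w` in `H¹_θ(0,1)` with
`∫₀¹ |(|x - a|^θ w')'|² < ∞`, the flux being locally absolutely continuous in `(0,a)` and in
`(a,1)`. By the energy bound in `H¹_θ` the flux then tends to `0` at `a` from both sides, so that
its a.e. derivative is its weak derivative on all of `(0,1)`. -/
structure MemH2 (a θ : ℝ) (w : ℝ → 𝕜) : Prop extends MemH1 a θ w where
  flux_ac_left : ∀ b ∈ Ioo 0 a, ∀ c ∈ Ioo 0 a,
    AbsolutelyContinuousOnInterval (degFlux a θ w) b c
  flux_ac_right : ∀ b ∈ Ioo a 1, ∀ c ∈ Ioo a 1,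
    AbsolutelyContinuousOnInterval (degFlux a θ w) b c
  op_memLp : MemLp (degOp a θ w) 2 unitMeasure

/-- `(μ, φ)` is a nontrivial solution of
`-(|x - a|^θ φ')' = μ φ` in `(0,1)`, `φ(0) = 0 = φ(1)`, with `φ` in the domain `H²_θ(0,1)`. -/
structure IsEigenpair (a θ : ℝ) (μ : 𝕜) (φ : ℝ → 𝕜) : Prop where
  mem : MemH2 a θ φ
  nontrivial : ¬ φ =ᵐ[unitMeasure] 0
  eqn : ∀ᵐ x ∂unitMeasure, -degOp a θ φ x = μ * φ x

end Operator

/-- The eigenvalues attached to `(a,1)`. -/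
def eigvalRight (a θ : ℝ) (n : ℕ) : ℝ :=
  degExp θ ^ 2 * besselZero (degOrder θ) n ^ 2 / (1 - a) ^ (2 * degExp θ)

/-- The eigenvalues attached to `(0,a)`. -/
def eigvalLeft (a θ : ℝ) (n : ℕ) : ℝ :=
  degExp θ ^ 2 * besselZero (degOrder θ) n ^ 2 / a ^ (2 * degExp θ)

/-- The normalized eigenfunctions supported on `(a,1)`. -/
def eigfunRight (a θ : ℝ) (n : ℕ) (x : ℝ) : ℝ :=
  if x < a then 0 else
    √(2 * degExp θ / (1 - a)) / |deriv (besselJ (degOrder θ)) (besselZero (degOrder θ) n)| *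
      ((x - a) / (1 - a)) ^ ((1 - θ) / 2) *
      besselJ (degOrder θ) (besselZero (degOrder θ) n * ((x - a) / (1 - a)) ^ degExp θ)

/-- The normalized eigenfunctions supported on `(0,a)`. -/
def eigfunLeft (a θ : ℝ) (n : ℕ) (x : ℝ) : ℝ :=
  if x < a then
    √(2 * degExp θ / a) / |deriv (besselJ (degOrder θ)) (besselZero (degOrder θ) n)| *
      |(x - a) / a| ^ ((1 - θ) / 2) *
      besselJ (degOrder θ) (besselZero (degOrder θ) n * |(x - a) / a| ^ degExp θ)
  else 0

end

/-!
On each side of the degenerate point `a`, the substitution `x = a + σ r` with `σ = 1 - a` or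
`σ = -a` turns `-(|x - a|^θ φ')' = μ φ` into `-(r^θ u')' = λ u` on `(0,1)`, with
`λ = μ |σ|^{2-θ}` and `u(1) = 0`. The energy bound makes the flux `p = r^θ u'` vanish at `0`,
because `r^{-θ}` is not integrable there for `θ ≥ 1` (`IsDegSolution.tendsto_flux_zero`), so the two
sides decouple.

Write `J_ν(z) = (z/2)^ν F_ν(z²/4)` with `F_ν` entire (`besselEntire`). Then
`y_λ(r) = F_ν(λ r^{2-θ} / (2-θ)²)` (`degProfile`) solves the equation and is bounded at `0`, and
`y_λ(1) = 0` exactly when `√λ = k z` for a zero `z` of `J_ν`. Green's formula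
(`IsDegSolution.green`) has no boundary term at `0`; it gives orthogonality of any solution with
vanishing flux to `y_λ` for different `λ`. Pohozaev's identity (`integral_degProfile_sq`) gives the
norm of `y_λ` and shows that the zeros of `J_ν` are simple.

Completeness is the core (`ae_eq_zero_of_forall_integral_degProfile_eq_zero`). The operator
`S f(t) = t^{-θ/2} ∫_0^t f` is Hilbert-Schmidt on `L²(0,1)`, hence compact, and `S† S` inverts
`-(r^θ u')'` with the boundary conditions above. By the spectral theorem it is enough to
describe the eigenvectors `u` of `S† S`. Testing against indicators of `(0,x]` shows that `u` is a
classical solution with vanishing flux at `0` and `u(1) = 0`. Green's formula with `y_λ` for this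
`λ` then gives `y_λ(1) p(1) = 0`. Uniqueness for the Cauchy problem at the regular endpoint `1`
excludes `p(1) = 0` and shows that `u` is a multiple of `y_λ` (`inner_eigenvector_eq_zero`).

Completeness also yields the rest. If `J_ν` had finitely many positive zeros, a nonzero polynomial
would be orthogonal to all `y_λ` with `y_λ(1) = 0` (`infinite_besselJ_zeros`). An eigenfunction
for a number `μ` outside the list would be orthogonal to a complete system
(`IsEigenpair.mem_range`).
-/

open Filter Topology

/-! ### The entire function behind the Bessel function -/

/-- The coefficients of the entire function `besselEntire`. -/
noncomputable def besselCoeff (ν : ℝ) (k : ℕ) : ℝ :=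
  (-1 : ℝ) ^ k / ((k.factorial : ℝ) * Real.Gamma ((k : ℝ) + ν + 1))

/-- The entire function `F_ν(w) = ∑ (-1)^k w^k / (k! Γ(k + ν + 1))`, for which
`J_ν(z) = (z / 2)^ν F_ν(z² / 4)`. -/
noncomputable def besselEntire (ν w : ℝ) : ℝ := ∑' k : ℕ, besselCoeff ν k * w ^ k

lemma Gamma_le_Gamma_add_nat {ν : ℝ} (hν : 0 ≤ ν) (k : ℕ) :
    Real.Gamma (ν + 1) ≤ Real.Gamma ((k : ℝ) + ν + 1) := by
  induction k with
  | zero => simp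
  | succ k ih =>
    have h : ((k + 1 : ℕ) : ℝ) + ν + 1 = ((k : ℝ) + ν + 1) + 1 := by push_cast; ring
    have hk : (0 : ℝ) ≤ k := k.cast_nonneg
    have hpos : 0 < Real.Gamma ((k : ℝ) + ν + 1) := Real.Gamma_pos_of_pos (by linarith)
    rw [h, Real.Gamma_add_one (s := (k : ℝ) + ν + 1) (by positivity)]
    nlinarith [mul_nonneg (add_nonneg hk hν) hpos.le]

lemma abs_besselCoeff_le {ν : ℝ} (hν : 0 ≤ ν) (k : ℕ) :
    |besselCoeff ν k| ≤ (Real.Gamma (ν + 1))⁻¹ * (1 / (k.factorial : ℝ)) := by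
  have h0 : 0 < Real.Gamma (ν + 1) := Real.Gamma_pos_of_pos (by linarith)
  have h1 := Gamma_le_Gamma_add_nat hν k
  have h2 : (0 : ℝ) < k.factorial := by positivity
  rw [besselCoeff, abs_div, abs_pow, abs_neg, abs_one, one_pow,
    abs_of_pos (mul_pos h2 (h0.trans_le h1)), inv_eq_one_div, div_mul_div_comm, one_mul,
    mul_comm (Real.Gamma (ν + 1))]
  gcongr

lemma summable_besselEntire {ν : ℝ} (hν : 0 ≤ ν) (w : ℝ) :
    Summable fun k : ℕ => besselCoeff ν k * w ^ k := by
  refine Summable.of_norm_bounded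
    ((Real.summable_pow_div_factorial |w|).mul_left (Real.Gamma (ν + 1))⁻¹) fun k => ?_
  rw [Real.norm_eq_abs, abs_mul, abs_pow]
  calc |besselCoeff ν k| * |w| ^ k
      ≤ ((Real.Gamma (ν + 1))⁻¹ * (1 / (k.factorial : ℝ))) * |w| ^ k := by
        gcongr; exact abs_besselCoeff_le hν k
    _ = _ := by ring

lemma succ_mul_besselCoeff_succ (ν : ℝ) (k : ℕ) :
    ((k : ℝ) + 1) * besselCoeff ν (k + 1) = -besselCoeff (ν + 1) k := by
  have hk : ((k : ℝ) + 1) ≠ 0 := by positivity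
  have h : ((k + 1 : ℕ) : ℝ) + ν + 1 = (k : ℝ) + (ν + 1) + 1 := by push_cast; ring
  rw [besselCoeff, besselCoeff, h, Nat.factorial_succ, pow_succ]
  push_cast
  rw [mul_assoc, ← mul_div_assoc, mul_div_mul_left _ _ hk]
  ring

lemma besselCoeff_eq_mul {ν : ℝ} (hν : 0 ≤ ν) (k : ℕ) :
    besselCoeff ν k = ((k : ℝ) + ν + 1) * besselCoeff (ν + 1) k := by
  have hk : (0 : ℝ) ≤ k := k.cast_nonneg
  have h1 : ((k : ℝ) + ν + 1) ≠ 0 := by positivity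
  have h2 : Real.Gamma ((k : ℝ) + ν + 1) ≠ 0 := (Real.Gamma_pos_of_pos (by positivity)).ne'
  have h : (k : ℝ) + (ν + 1) + 1 = ((k : ℝ) + ν + 1) + 1 := by ring
  rw [besselCoeff, besselCoeff, h, Real.Gamma_add_one h1]
  field_simp

/-- `F_ν' = -F_{ν+1}`, the rule `(z^{-ν} J_ν)' = -z^{-ν} J_{ν+1}` in terms of `w = z² / 4`. -/
lemma hasDerivAt_besselEntire {ν : ℝ} (hν : 0 ≤ ν) (w : ℝ) :
    HasDerivAt (besselEntire ν) (-besselEntire (ν + 1) w) w := by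
  set R : ℝ := |w| + 1
  have hR : 0 ≤ R := by positivity
  have hw : w ∈ Metric.ball (0 : ℝ) R := by simp [R]
  have hshift : ∀ z : ℝ, ∀ k : ℕ, besselCoeff ν (k + 1) * (((k + 1 : ℕ) : ℝ) * z ^ (k + 1 - 1))
      = -(besselCoeff (ν + 1) k * z ^ k) := fun z k => by
    have := succ_mul_besselCoeff_succ ν k
    push_cast
    rw [← mul_assoc, mul_comm (besselCoeff ν (k + 1)), this]
    ring
  have hu : Summable fun k : ℕ => |besselCoeff ν k * ((k : ℝ) * R ^ (k - 1))| := by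
    rw [← summable_nat_add_iff 1]
    simp_rw [hshift]
    simpa using (summable_besselEntire (ν := ν + 1) (by linarith) R).abs
  have key := hasDerivAt_tsum_of_isPreconnected hu Metric.isOpen_ball
    (convex_ball (0 : ℝ) R).isPreconnected
    (g := fun k z => besselCoeff ν k * z ^ k)
    (g' := fun k z => besselCoeff ν k * ((k : ℝ) * z ^ (k - 1)))
    (fun k z _ => (hasDerivAt_pow k z).const_mul _)
    (fun k z hz => by
      have hz' : |z| ≤ R := by simpa using (mem_ball_zero_iff.1 hz).le
      rw [Real.norm_eq_abs, abs_mul, abs_mul, abs_mul, abs_mul, abs_pow, abs_pow,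
        abs_of_nonneg hR]
      gcongr) hw (summable_besselEntire hν w) hw
  have hs : Summable fun k : ℕ => besselCoeff ν k * ((k : ℝ) * w ^ (k - 1)) := by
    rw [← summable_nat_add_iff 1]
    simp_rw [hshift]
    exact (summable_besselEntire (ν := ν + 1) (by linarith) w).neg
  rw [hs.tsum_eq_zero_add] at key
  simp_rw [hshift] at key
  simp only [CharP.cast_eq_zero, zero_mul, mul_zero, zero_add, tsum_neg] at key
  exact key

lemma continuous_besselEntire {ν : ℝ} (hν : 0 ≤ ν) : Continuous (besselEntire ν) :=
  continuous_iff_continuousAt.2 fun w => (hasDerivAt_besselEntire hν w).continuousAt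

/-- The three term recurrence of Bessel functions. With `hasDerivAt_besselEntire` it amounts to the
differential equation `w F'' + (ν + 1) F' + F = 0`. -/
lemma besselEntire_recurrence {ν : ℝ} (hν : 0 ≤ ν) (w : ℝ) :
    besselEntire ν w = (ν + 1) * besselEntire (ν + 1) w - w * besselEntire (ν + 2) w := by
  have hν1 : 0 ≤ ν + 1 := by linarith
  have hshift : ∀ k : ℕ, ((k + 1 : ℕ) : ℝ) * (besselCoeff (ν + 1) (k + 1) * w ^ (k + 1))
      = -(w * (besselCoeff (ν + 2) k * w ^ k)) := fun k => by
    have := succ_mul_besselCoeff_succ (ν + 1) k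
    rw [show ν + 1 + 1 = ν + 2 by ring] at this
    push_cast
    rw [← mul_assoc, this]
    ring
  have hsum2 := (summable_besselEntire (ν := ν + 2) (by linarith) w).mul_left w
  have hs : Summable fun k : ℕ => (k : ℝ) * (besselCoeff (ν + 1) k * w ^ k) := by
    rw [← summable_nat_add_iff 1]
    simp_rw [hshift]
    exact hsum2.neg
  have h1 : besselEntire ν w = ∑' k : ℕ, ((ν + 1) * (besselCoeff (ν + 1) k * w ^ k)
      + (k : ℝ) * (besselCoeff (ν + 1) k * w ^ k)) := by
    refine tsum_congr fun k => ?_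
    rw [besselCoeff_eq_mul hν]
    ring
  rw [h1, ((summable_besselEntire hν1 w).mul_left _).tsum_add hs, tsum_mul_left,
    hs.tsum_eq_zero_add]
  simp_rw [hshift]
  rw [tsum_neg, tsum_mul_left]
  simp [besselEntire, sub_eq_add_neg]

lemma besselEntire_zero_pos {ν : ℝ} (hν : 0 ≤ ν) : 0 < besselEntire ν 0 := by
  have : besselEntire ν 0 = (Real.Gamma (ν + 1))⁻¹ := by
    rw [besselEntire, tsum_eq_single 0 (fun k hk => by simp [hk])]
    simp [besselCoeff]
  rw [this]
  exact inv_pos.2 (Real.Gamma_pos_of_pos (by linarith))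

lemma besselJ_eq {ν z : ℝ} (hz : 0 < z) :
    besselJ ν z = (z / 2) ^ ν * besselEntire ν (z ^ 2 / 4) := by
  rw [besselJ, besselEntire, ← tsum_mul_left]
  refine tsum_congr fun k => ?_
  have h2 : (z / 2) ^ (2 * (k : ℝ) + ν) = (z / 2) ^ ν * (z ^ 2 / 4) ^ k := by
    rw [add_comm, Real.rpow_add (by positivity), Real.rpow_mul (by positivity), Real.rpow_natCast]
    norm_num [div_pow]
  rw [h2, besselCoeff]
  ring

lemma besselJ_eq_zero_iff {ν z : ℝ} (hz : 0 < z) :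
    besselJ ν z = 0 ↔ besselEntire ν (z ^ 2 / 4) = 0 := by
  rw [besselJ_eq hz, mul_eq_zero, or_iff_right (Real.rpow_pos_of_pos (by positivity) ν).ne']

/-- At a zero of `J_ν` the factor `(z / 2)^ν` does not contribute to the derivative. -/
lemma hasDerivAt_besselJ_of_eq_zero {ν z : ℝ} (hν : 0 ≤ ν) (hz : 0 < z) (h0 : besselJ ν z = 0) :
    HasDerivAt (besselJ ν) (-((z / 2) ^ ν * (z / 2) * besselEntire (ν + 1) (z ^ 2 / 4))) z := by
  have h1 : HasDerivAt (fun x : ℝ => (x / 2) ^ ν) (1 / 2 * ν * (z / 2) ^ (ν - 1)) z :=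
    ((hasDerivAt_id z).div_const 2).rpow_const (Or.inl (by simp; positivity))
  have h2 : HasDerivAt (fun x : ℝ => x ^ 2 / 4) (2 * z / 4) z := by
    simpa using (hasDerivAt_pow 2 z).div_const 4
  have h3 := h1.mul ((hasDerivAt_besselEntire hν (z ^ 2 / 4)).comp z h2)
  have h4 : HasDerivAt (besselJ ν) _ z := h3.congr_of_eventuallyEq <| by
    filter_upwards [lt_mem_nhds hz] with x hx using besselJ_eq hx
  convert h4 using 1
  simp only [Function.comp_apply, (besselJ_eq_zero_iff hz).1 h0]
  ring

/-! ### Bounded solutions and the first order system on the unit interval -/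

/-- The solution of `-(r^θ y')' = λ y` on `(0, ∞)` that stays bounded at the degenerate
endpoint `0`; up to a power of `r` and a constant it is `J_ν` at a multiple of `r^k`, where
`ν = degOrder θ` and `k = degExp θ`. -/
noncomputable def degProfile (θ lam r : ℝ) : ℝ :=
  besselEntire (degOrder θ) (lam * r ^ (2 - θ) / (2 - θ) ^ 2)

/-- The flux `r^θ y'` of the solution `y = degProfile θ lam`. -/
noncomputable def degProfileFlux (θ lam r : ℝ) : ℝ :=
  -(lam / (2 - θ)) * r * besselEntire (degOrder θ + 1) (lam * r ^ (2 - θ) / (2 - θ) ^ 2)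

section Profile

variable {θ : ℝ}

lemma degOrder_nonneg (hθ : θ < 2) : 0 ≤ degOrder θ :=
  div_nonneg (abs_nonneg _) (by linarith)

lemma degOrder_add_one_mul (hθ : θ ∈ Ico (1 : ℝ) 2) : (degOrder θ + 1) * (2 - θ) = 1 := by
  have h : 2 - θ ≠ 0 := by linarith [hθ.2]
  rw [degOrder, abs_of_nonneg (by linarith [hθ.1])]
  field_simp
  ring

lemma hasDerivAt_degProfile_arg (hθ : θ < 2) (lam : ℝ) {r : ℝ} (hr : 0 < r) :
    HasDerivAt (fun x : ℝ => lam * x ^ (2 - θ) / (2 - θ) ^ 2) (lam * r ^ (1 - θ) / (2 - θ)) r := by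
  have h : 2 - θ ≠ 0 := by linarith
  have h1 := ((Real.hasDerivAt_rpow_const (p := 2 - θ) (Or.inl hr.ne')).const_mul lam).div_const
    ((2 - θ) ^ 2)
  refine h1.congr_deriv ?_
  rw [show 2 - θ - 1 = 1 - θ by ring]
  field_simp

lemma hasDerivAt_degProfile (hθ : θ < 2) (lam : ℝ) {r : ℝ} (hr : 0 < r) :
    HasDerivAt (degProfile θ lam) (r ^ (-θ) * degProfileFlux θ lam r) r := by
  have h1 := (hasDerivAt_besselEntire (degOrder_nonneg hθ) _).comp r
    (hasDerivAt_degProfile_arg hθ lam hr)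
  refine HasDerivAt.congr_deriv (f := degProfile θ lam) h1 ?_
  rw [degProfileFlux, show 1 - θ = -θ + 1 by ring, Real.rpow_add_one hr.ne']
  ring

lemma hasDerivAt_degProfileFlux (hθ : θ ∈ Ico (1 : ℝ) 2) (lam : ℝ) {r : ℝ} (hr : 0 < r) :
    HasDerivAt (degProfileFlux θ lam) (-(lam * degProfile θ lam r)) r := by
  have hν := degOrder_nonneg hθ.2
  have h2 : 2 - θ ≠ 0 := by linarith [hθ.2]
  have h1 := ((hasDerivAt_id r).const_mul (-(lam / (2 - θ)))).mul
    ((hasDerivAt_besselEntire (ν := degOrder θ + 1) (by linarith) _).comp r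
      (hasDerivAt_degProfile_arg hθ.2 lam hr))
  refine HasDerivAt.congr_deriv (f := degProfileFlux θ lam) h1 ?_
  rw [degProfile, besselEntire_recurrence hν, show degOrder θ + 1 + 1 = degOrder θ + 2 by ring]
  have h3 : r ^ (2 - θ) = r * r ^ (1 - θ) := by
    rw [show 2 - θ = (1 - θ) + 1 by ring, Real.rpow_add_one hr.ne', mul_comm]
  have h4 : degOrder θ + 1 = 1 / (2 - θ) := by
    rw [eq_div_iff h2]; exact degOrder_add_one_mul hθ
  simp only [Function.comp_apply, id, mul_one]
  rw [h3]
  generalize besselEntire (degOrder θ + 2) _ = B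
  generalize hA : besselEntire (degOrder θ + 1) _ = A
  rw [h4]
  field_simp
  ring

lemma continuous_degProfile_arg (hθ : θ < 2) (lam : ℝ) :
    Continuous fun x : ℝ => lam * x ^ (2 - θ) / (2 - θ) ^ 2 :=
  (continuous_const.mul (Real.continuous_rpow_const (by linarith))).div_const _

lemma continuous_degProfile (hθ : θ < 2) (lam : ℝ) : Continuous (degProfile θ lam) :=
  (continuous_besselEntire (degOrder_nonneg hθ)).comp (continuous_degProfile_arg hθ lam)

lemma continuous_degProfileFlux (hθ : θ < 2) (lam : ℝ) : Continuous (degProfileFlux θ lam) :=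
  (continuous_const.mul continuous_id).mul
    ((continuous_besselEntire (by linarith [degOrder_nonneg hθ])).comp
      (continuous_degProfile_arg hθ lam))

lemma degProfile_zero_pos (hθ : θ < 2) (lam : ℝ) : 0 < degProfile θ lam 0 := by
  rw [degProfile, Real.zero_rpow (by linarith), mul_zero, zero_div]
  exact besselEntire_zero_pos (degOrder_nonneg hθ)

@[simp] lemma degProfileFlux_zero (lam : ℝ) : degProfileFlux θ lam 0 = 0 := by
  simp [degProfileFlux]

end Profile

section Solution

variable {𝕜 : Type*} [RCLike 𝕜]

/-- `u` solves `-(r^θ u')' = μ u` on `(0,1)` with flux `p = r^θ u'`, as a first order system. -/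
structure IsDegSolution (θ : ℝ) (μ : 𝕜) (u p : ℝ → 𝕜) : Prop where
  hasDerivAt : ∀ r ∈ Ioo (0 : ℝ) 1, HasDerivAt u ((r ^ (-θ) : ℝ) • p r) r
  hasDerivAt_flux : ∀ r ∈ Ioo (0 : ℝ) 1, HasDerivAt p (-(μ * u r)) r

variable {θ : ℝ} {μ : 𝕜} {u p : ℝ → 𝕜}

lemma isDegSolution_degProfile (hθ : θ ∈ Ico (1 : ℝ) 2) (lam : ℝ) :
    IsDegSolution θ lam (degProfile θ lam) (degProfileFlux θ lam) :=
  ⟨fun _ hr => hasDerivAt_degProfile hθ.2 lam hr.1,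
    fun _ hr => hasDerivAt_degProfileFlux hθ lam hr.1⟩

/-- A solution whose flux vanishes at the degenerate endpoint is `o(1 / r)` there: if the flux is
at most `1` on `(0, c]`, then `‖u'(t)‖ ≤ t^{-θ} ≤ r^{-θ/2} t^{-θ/2}` for `r ≤ t ≤ c`, and
`t^{-θ/2}` is integrable. -/
lemma IsDegSolution.tendsto_smul_self (h : IsDegSolution θ μ u p) (hθ : θ ∈ Ico (1 : ℝ) 2)
    (hp : Tendsto p (𝓝[>] 0) (𝓝 0)) :
    Tendsto (fun r : ℝ => r • u r) (𝓝[>] 0) (𝓝 0) := by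
  have hθ1 := hθ.1
  have hθ2 := hθ.2
  have hev : ∀ᶠ r in 𝓝[>] (0 : ℝ), ‖p r‖ < 1 := by
    have := (tendsto_zero_iff_norm_tendsto_zero.1 hp).eventually (gt_mem_nhds one_pos)
    exact this
  obtain ⟨d, hd0, hd⟩ := (mem_nhdsGT_iff_exists_Ioo_subset).1 hev
  have hd0 : 0 < d := hd0
  set c : ℝ := min (d / 2) (1 / 2)
  have hc0 : 0 < c := lt_min (by positivity) (by norm_num)
  have hcd : c < d := (min_le_left _ _).trans_lt (by linarith)
  have hc1 : c < 1 := (min_le_right _ _).trans_lt (by norm_num)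
  set C : ℝ := 1 / (1 - θ / 2)
  have hbound : ∀ r ∈ Ioo 0 c, ‖r • u r‖ ≤ r * ‖u c‖ + r ^ (1 - θ / 2) * C := by
    intro r hr
    have hsub : ∀ t ∈ uIcc r c, t ∈ Ioo (0 : ℝ) 1 ∧ t ∈ Ioo (0 : ℝ) d := by
      intro t ht
      rw [uIcc_of_le hr.2.le] at ht
      exact ⟨⟨hr.1.trans_le ht.1, ht.2.trans_lt hc1⟩, ⟨hr.1.trans_le ht.1, ht.2.trans_lt hcd⟩⟩
    have hcont : ContinuousOn (fun t : ℝ => (t ^ (-θ) : ℝ) • p t) (uIcc r c) := fun t ht =>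
      ((Real.continuousAt_rpow_const _ _ (Or.inl (hsub t ht).1.1.ne')).smul
        (h.hasDerivAt_flux t (hsub t ht).1).continuousAt).continuousWithinAt
    have hftc := intervalIntegral.integral_eq_sub_of_hasDerivAt
      (fun t ht => h.hasDerivAt t (hsub t ht).1) hcont.intervalIntegrable
    have hint : IntervalIntegrable (fun t : ℝ => r ^ (-(θ / 2)) * t ^ (-(θ / 2))) volume r c :=
      (intervalIntegral.intervalIntegrable_rpow' (by linarith)).const_mul _
    have hle : ‖∫ t in r..c, (t ^ (-θ) : ℝ) • p t‖ ≤
        ∫ t in r..c, r ^ (-(θ / 2)) * t ^ (-(θ / 2)) := by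
      refine intervalIntegral.norm_integral_le_of_norm_le hr.2.le ?_ hint
      refine Eventually.of_forall fun t ht => ?_
      have ht0 : 0 < t := hr.1.trans ht.1
      have hpt : ‖p t‖ < 1 := hd ⟨ht0, ht.2.trans_lt hcd⟩
      rw [norm_smul, Real.norm_eq_abs, abs_of_pos (Real.rpow_pos_of_pos ht0 _)]
      calc t ^ (-θ) * ‖p t‖ ≤ t ^ (-θ) * 1 := by gcongr
        _ = t ^ (-(θ / 2)) * t ^ (-(θ / 2)) := by
          rw [mul_one, ← Real.rpow_add ht0]; congr 1; ring
        _ ≤ r ^ (-(θ / 2)) * t ^ (-(θ / 2)) := by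
          gcongr ?_ * _
          exact Real.rpow_le_rpow_of_nonpos hr.1 ht.1.le (by linarith)
    have hval : ∫ t in r..c, r ^ (-(θ / 2)) * t ^ (-(θ / 2)) ≤ r ^ (-(θ / 2)) * C := by
      rw [intervalIntegral.integral_const_mul, integral_rpow (Or.inl (by linarith))]
      refine mul_le_mul_of_nonneg_left ?_ (Real.rpow_nonneg hr.1.le _)
      rw [show -(θ / 2) + 1 = 1 - θ / 2 by ring]
      have e1 : c ^ (1 - θ / 2) ≤ 1 := Real.rpow_le_one hc0.le hc1.le (by linarith)
      have e2 : 0 < r ^ (1 - θ / 2) := Real.rpow_pos_of_pos hr.1 _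
      have e3 : 0 < 1 - θ / 2 := by linarith
      simp only [C]
      gcongr
      linarith
    have hu : u r = u c - ∫ t in r..c, (t ^ (-θ) : ℝ) • p t := by rw [hftc]; abel
    rw [norm_smul, Real.norm_eq_abs, abs_of_pos hr.1]
    calc r * ‖u r‖ ≤ r * (‖u c‖ + r ^ (-(θ / 2)) * C) := by
          have := norm_sub_le (u c) (∫ t in r..c, (t ^ (-θ) : ℝ) • p t)
          rw [← hu] at this
          have hr0 := hr.1.le
          gcongr
          linarith
      _ = r * ‖u c‖ + r ^ (1 - θ / 2) * C := by
          rw [show 1 - θ / 2 = -(θ / 2) + 1 by ring, Real.rpow_add_one hr.1.ne']; ring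
  refine squeeze_zero_norm' (a := fun r => r * ‖u c‖ + r ^ (1 - θ / 2) * C) ?_ ?_
  · filter_upwards [Ioo_mem_nhdsGT hc0] with r hr using hbound r hr
  · have hcont : Continuous fun r : ℝ => r * ‖u c‖ + r ^ (1 - θ / 2) * C :=
      (continuous_id.mul continuous_const).add
        ((Real.continuous_rpow_const (by linarith)).mul continuous_const)
    have := hcont.tendsto 0
    rw [zero_mul, Real.zero_rpow (by linarith), zero_mul, zero_add] at this
    exact this.mono_left nhdsWithin_le_nhds

lemma IsDegSolution.flux_eq (h : IsDegSolution θ μ u p) (hu : IntervalIntegrable u volume 0 1)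
    {r c : ℝ} (hr : r ∈ Ioo (0 : ℝ) 1) (hc : c ∈ Ioo (0 : ℝ) 1) :
    p r = p c - μ * ∫ t in c..r, u t := by
  have hsub : uIcc c r ⊆ Ioo (0 : ℝ) 1 := ordConnected_Ioo.uIcc_subset hc hr
  have h1 := intervalIntegral.integral_eq_sub_of_hasDerivAt
    (fun t ht => h.hasDerivAt_flux t (hsub ht))
    (((hu.mono_set (hsub.trans (Ioo_subset_Icc_self.trans Icc_subset_uIcc))).const_mul μ).neg)
  rw [intervalIntegral.integral_neg, intervalIntegral.integral_const_mul] at h1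
  rw [sub_eq_add_neg, h1]
  abel

/-- The flux of an integrable solution has limits at both endpoints. -/
lemma IsDegSolution.exists_tendsto_flux (h : IsDegSolution θ μ u p)
    (hu : IntervalIntegrable u volume 0 1) :
    (∃ L, Tendsto p (𝓝[>] 0) (𝓝 L)) ∧ ∃ L, Tendsto p (𝓝[<] 1) (𝓝 L) := by
  have hc : (1 / 2 : ℝ) ∈ Ioo (0 : ℝ) 1 := by norm_num
  have hcont : ContinuousOn (fun r => p (1 / 2) - μ * ∫ t in (1 / 2 : ℝ)..r, u t) (Icc 0 1) := by
    have := intervalIntegral.continuousOn_primitive_interval' hu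
      (show (1 / 2 : ℝ) ∈ uIcc (0 : ℝ) 1 by rw [uIcc_of_le zero_le_one]; norm_num)
    rw [uIcc_of_le zero_le_one] at this
    exact continuousOn_const.sub (continuousOn_const.mul this)
  constructor
  · refine ⟨_, Tendsto.congr' ?_ ((hcont 0 (by simp)).mono_left
      (nhdsWithin_le_of_mem (Icc_mem_nhdsGT zero_lt_one)))⟩
    filter_upwards [Ioo_mem_nhdsGT zero_lt_one] with r hr using (h.flux_eq hu hr hc).symm
  · refine ⟨_, Tendsto.congr' ?_ ((hcont 1 (by simp)).mono_left
      (nhdsWithin_le_of_mem (Icc_mem_nhdsLT zero_lt_one)))⟩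
    filter_upwards [Ioo_mem_nhdsLT zero_lt_one] with r hr using (h.flux_eq hu hr hc).symm

/-- The energy bound forces the flux to vanish at the degenerate endpoint, since `r^{-θ}` is not
integrable there when `1 ≤ θ`. -/
lemma IsDegSolution.tendsto_flux_zero (h : IsDegSolution θ μ u p) (hθ : 1 ≤ θ)
    (hu : IntervalIntegrable u volume 0 1)
    (hE : IntegrableOn (fun r : ℝ => r ^ (-θ) * ‖p r‖ ^ 2) (Ioo 0 1)) :
    Tendsto p (𝓝[>] 0) (𝓝 0) := by
  obtain ⟨L, hL⟩ := (h.exists_tendsto_flux hu).1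
  suffices L = 0 by rwa [this] at hL
  by_contra hL0
  have hL1 : 0 < ‖L‖ := norm_pos_iff.2 hL0
  have hev : ∀ᶠ r in 𝓝[>] (0 : ℝ), ‖L‖ / 2 < ‖p r‖ :=
    hL.norm.eventually (lt_mem_nhds (by linarith))
  obtain ⟨d, hd0, hd⟩ := (mem_nhdsGT_iff_exists_Ioo_subset' zero_lt_one).1 hev
  set c := min d 1
  have hc0 : 0 < c := lt_min hd0 one_pos
  have hint : IntegrableOn (fun r : ℝ => (‖L‖ / 2) ^ 2 * r ^ (-θ)) (Ioo 0 c) := by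
    refine Integrable.mono' (hE.mono_set (Ioo_subset_Ioo_right (min_le_right _ _))) ?_ ?_
    · exact (measurable_const.mul (measurable_id.pow_const _)).aestronglyMeasurable
    · refine (ae_restrict_iff' measurableSet_Ioo).2 (Eventually.of_forall fun r hr => ?_)
      have hr0 := Real.rpow_pos_of_pos hr.1 (-θ)
      have h1 : ‖L‖ / 2 < ‖p r‖ := hd ⟨hr.1, hr.2.trans_le (min_le_left _ _)⟩
      rw [Real.norm_eq_abs, abs_of_nonneg (by positivity), mul_comm]
      gcongr
  have h2 : IntegrableOn (fun r : ℝ => r ^ (-θ)) (Ioo 0 c) := by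
    refine (integrable_const_mul_iff (IsUnit.mk0 ((‖L‖ / 2) ^ 2) (by positivity)) _).1 hint
  rw [intervalIntegral.integrableOn_Ioo_rpow_iff hc0] at h2
  linarith

/-- Green's formula between a solution with vanishing flux at the degenerate endpoint and the
bounded real solution for `lam`: the boundary term at `0` vanishes. -/
lemma IsDegSolution.green (h : IsDegSolution θ μ u p) (hθ : θ ∈ Ico (1 : ℝ) 2)
    (hp : Tendsto p (𝓝[>] 0) (𝓝 0)) (hu : IntervalIntegrable u volume 0 1) (lam : ℝ) {b : 𝕜}
    (hb : Tendsto (fun r => degProfileFlux θ lam r • u r - degProfile θ lam r • p r) (𝓝[<] 1)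
      (𝓝 b)) :
    (μ - (lam : 𝕜)) * ∫ r in (0 : ℝ)..1, degProfile θ lam r • u r = b := by
  set y := degProfile θ lam
  set q := degProfileFlux θ lam
  have hyc : Continuous y := continuous_degProfile hθ.2 lam
  have hqc : Continuous q := continuous_degProfileFlux hθ.2 lam
  have hder : ∀ r ∈ Ioo (0 : ℝ) 1, HasDerivAt (fun r => q r • u r - y r • p r)
      ((μ - (lam : 𝕜)) * (y r • u r)) r := by
    intro r hr
    have h1 := ((hasDerivAt_degProfileFlux hθ lam hr.1).smul (h.hasDerivAt r hr)).sub
      ((hasDerivAt_degProfile hθ.2 lam hr.1).smul (h.hasDerivAt_flux r hr))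
    refine h1.congr_deriv ?_
    simp only [RCLike.real_smul_eq_coe_mul, y]
    push_cast
    ring
  have hzero : Tendsto (fun r => q r • u r - y r • p r) (𝓝[>] 0) (𝓝 0) := by
    have h1 : Tendsto (fun r => (-(lam / (2 - θ)) *
        besselEntire (degOrder θ + 1) (lam * r ^ (2 - θ) / (2 - θ) ^ 2)) • (r • u r))
        (𝓝[>] 0) (𝓝 0) := by
      have hc : Continuous fun r : ℝ => -(lam / (2 - θ)) *
          besselEntire (degOrder θ + 1) (lam * r ^ (2 - θ) / (2 - θ) ^ 2) :=
        continuous_const.mul ((continuous_besselEntire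
          (by linarith [degOrder_nonneg hθ.2])).comp (continuous_degProfile_arg hθ.2 lam))
      simpa using ((hc.tendsto 0).mono_left nhdsWithin_le_nhds).smul (h.tendsto_smul_self hθ hp)
    have h2 : Tendsto (fun r => y r • p r) (𝓝[>] 0) (𝓝 0) := by
      simpa using ((hyc.tendsto 0).mono_left nhdsWithin_le_nhds).smul hp
    have h3 := h1.sub h2
    rw [sub_zero] at h3
    refine h3.congr fun r => ?_
    simp only [q, degProfileFlux, smul_smul]
    congr 2
    ring
  have hint : IntervalIntegrable (fun r => (μ - (lam : 𝕜)) * (y r • u r)) volume 0 1 :=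
    (hu.continuousOn_smul hyc.continuousOn).const_mul _
  have := intervalIntegral.integral_eq_sub_of_hasDerivAt_of_tendsto zero_lt_one hder hint hzero hb
  rwa [intervalIntegral.integral_const_mul, sub_zero] at this

lemma IsDegSolution.integral_mul_eq_zero (h : IsDegSolution θ μ u p) (hθ : θ ∈ Ico (1 : ℝ) 2)
    (hp : Tendsto p (𝓝[>] 0) (𝓝 0)) (hu : IntervalIntegrable u volume 0 1)
    (hu1 : Tendsto u (𝓝[<] 1) (𝓝 0)) {lam : ℝ} (hlam : degProfile θ lam 1 = 0)
    (hne : μ ≠ (lam : 𝕜)) :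
    ∫ r in (0 : ℝ)..1, degProfile θ lam r • u r = 0 := by
  obtain ⟨L, hL⟩ := (h.exists_tendsto_flux hu).2
  have hy : Tendsto (degProfile θ lam) (𝓝[<] 1) (𝓝 0) := by
    rw [← hlam]
    exact ((continuous_degProfile hθ.2 lam).tendsto 1).mono_left nhdsWithin_le_nhds
  have hq := ((continuous_degProfileFlux hθ.2 lam).tendsto 1).mono_left
    (nhdsWithin_le_nhds (s := Iio 1))
  have hb := (hq.smul hu1).sub (hy.smul hL)
  rw [smul_zero, zero_smul, sub_zero] at hb
  exact (mul_eq_zero.1 (h.green hθ hp hu lam hb)).resolve_left (sub_ne_zero.2 hne)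

end Solution

section Real

variable {θ lam : ℝ} {u p : ℝ → ℝ}

/-- A solution with vanishing Cauchy data at the regular endpoint `1` is zero: with
`E = u² + p²` and `C` large, `E(r) exp(C r)` is monotone on `[δ, 1)` and tends to `0` at `1`. -/
lemma IsDegSolution.eq_zero (h : IsDegSolution θ lam u p) (hθ : 0 ≤ θ)
    (hu : Tendsto u (𝓝[<] 1) (𝓝 0)) (hp : Tendsto p (𝓝[<] 1) (𝓝 0)) :
    ∀ r ∈ Ioo (0 : ℝ) 1, u r = 0 ∧ p r = 0 := by
  intro d hd
  set C : ℝ := d ^ (-θ) + |lam|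
  set E : ℝ → ℝ := fun r => (u r ^ 2 + p r ^ 2) * Real.exp (C * r)
  have hder : ∀ r ∈ Ico d 1, HasDerivAt E
      ((2 * u r * (r ^ (-θ) * p r) + 2 * p r * (-(lam * u r))) * Real.exp (C * r) +
        (u r ^ 2 + p r ^ 2) * (Real.exp (C * r) * C)) r := by
    intro r hr
    have hr' : r ∈ Ioo (0 : ℝ) 1 := ⟨hd.1.trans_le hr.1, hr.2⟩
    have h1 := (((h.hasDerivAt r hr').pow 2).add ((h.hasDerivAt_flux r hr').pow 2)).mul
      (((hasDerivAt_id r).const_mul C).exp)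
    refine HasDerivAt.congr_deriv (f := E) h1 ?_
    simp
  have hmono : MonotoneOn E (Ico d 1) := by
    refine monotoneOn_of_deriv_nonneg (convex_Ico d 1)
      (fun r hr => (hder r hr).continuousAt.continuousWithinAt)
      (fun r hr => (hder r (interior_subset hr)).differentiableAt.differentiableWithinAt)
      (fun r hr => ?_)
    replace hr := interior_subset hr
    rw [(hder r hr).deriv]
    have hr0 : 0 < r := hd.1.trans_le hr.1
    have e1 : r ^ (-θ) ≤ d ^ (-θ) := Real.rpow_le_rpow_of_nonpos hd.1 hr.1 (by linarith)
    have e2 : 0 < r ^ (-θ) := Real.rpow_pos_of_pos hr0 _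
    have e3 := abs_le.1 (le_refl |lam|)
    have key : 0 ≤ (2 * u r * (r ^ (-θ) * p r) + 2 * p r * (-(lam * u r))) +
        (u r ^ 2 + p r ^ 2) * C := by
      have : |2 * (u r * p r) * (r ^ (-θ) - lam)| ≤ (u r ^ 2 + p r ^ 2) * C := by
        rw [abs_mul]
        gcongr
        · rw [abs_le]
          constructor <;> nlinarith [sq_nonneg (u r + p r), sq_nonneg (u r - p r)]
        · rw [abs_le]
          constructor <;> simp only [C] <;> linarith [e3.1, e3.2]
      have := (abs_le.1 this).1
      nlinarith
    have hexp := Real.exp_pos (C * r)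
    nlinarith [mul_nonneg key hexp.le]
  have hlim : Tendsto E (𝓝[<] 1) (𝓝 0) := by
    have hexp : Continuous fun r : ℝ => Real.exp (C * r) := by fun_prop
    have h1 := ((hu.pow 2).add (hp.pow 2)).mul
      ((hexp.tendsto 1).mono_left (nhdsWithin_le_nhds (s := Iio (1 : ℝ))))
    simpa using h1
  have hle : E d ≤ 0 := by
    refine ge_of_tendsto hlim ?_
    filter_upwards [Ioo_mem_nhdsLT hd.2] with r hr
    exact hmono (left_mem_Ico.2 hd.2) ⟨hr.1.le, hr.2⟩ hr.1.le
  have h2 : u d ^ 2 + p d ^ 2 ≤ 0 := by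
    by_contra! hcon
    exact absurd hle (not_le.2 (mul_pos hcon (Real.exp_pos _)))
  constructor <;> nlinarith [sq_nonneg (u d), sq_nonneg (p d)]

/-- The normalisation integral, from Pohozaev's identity: the derivative of
`r^{1-θ} p² + λ r y² + (θ - 1) p y` is `(2 - θ) λ y²`. -/
lemma integral_degProfile_sq (hθ : θ ∈ Ico (1 : ℝ) 2) (h1 : degProfile θ lam 1 = 0) :
    (2 - θ) * lam * ∫ r in (0 : ℝ)..1, degProfile θ lam r ^ 2 = degProfileFlux θ lam 1 ^ 2 := by
  set y := degProfile θ lam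
  set q := degProfileFlux θ lam
  have hyc : Continuous y := continuous_degProfile hθ.2 lam
  have hqc : Continuous q := continuous_degProfileFlux hθ.2 lam
  have hder : ∀ r ∈ Ioo (0 : ℝ) 1, HasDerivAt
      (fun r => r ^ (1 - θ) * q r ^ 2 + lam * r * y r ^ 2 + (θ - 1) * q r * y r)
      ((2 - θ) * lam * y r ^ 2) r := by
    intro r hr
    have hy := hasDerivAt_degProfile hθ.2 lam hr.1
    have hq := hasDerivAt_degProfileFlux hθ lam hr.1
    have hd := (((Real.hasDerivAt_rpow_const (p := 1 - θ) (Or.inl hr.1.ne')).mul (hq.pow 2)).add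
      (((hasDerivAt_id r).const_mul lam).mul (hy.pow 2))).add
        ((hq.const_mul (θ - 1)).mul hy)
    refine hd.congr_deriv ?_
    have e : r ^ (1 - θ) = r ^ (-θ) * r := by
      rw [show 1 - θ = -θ + 1 by ring, Real.rpow_add_one hr.1.ne']
    simp only [show 1 - θ - 1 = -θ by ring, e, Pi.pow_apply, id, y]
    push_cast
    ring
  have hzero : Tendsto
      (fun r => r ^ (1 - θ) * q r ^ 2 + lam * r * y r ^ 2 + (θ - 1) * q r * y r)
      (𝓝[>] 0) (𝓝 0) := by
    set B : ℝ → ℝ := fun r => -(lam / (2 - θ)) *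
      besselEntire (degOrder θ + 1) (lam * r ^ (2 - θ) / (2 - θ) ^ 2)
    have hB : Continuous B := continuous_const.mul ((continuous_besselEntire
      (by linarith [degOrder_nonneg hθ.2])).comp (continuous_degProfile_arg hθ.2 lam))
    have hpow : Continuous fun r : ℝ => r ^ (3 - θ) :=
      Real.continuous_rpow_const (by linarith [hθ.2])
    have hc : Continuous fun r => r ^ (3 - θ) * B r ^ 2 + lam * r * y r ^ 2 +
        (θ - 1) * q r * y r := by fun_prop
    have := hc.tendsto 0
    simp only [Real.zero_rpow (show 3 - θ ≠ 0 by linarith [hθ.2]), mul_zero, zero_mul, q,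
      degProfileFlux_zero, add_zero] at this
    refine (this.mono_left nhdsWithin_le_nhds).congr' ?_
    filter_upwards [self_mem_nhdsWithin] with r hr
    have hr : 0 < r := hr
    have e : r ^ (3 - θ) = r ^ (1 - θ) * r ^ 2 := by
      rw [← Real.rpow_natCast, ← Real.rpow_add hr]; congr 1; push_cast; ring
    have e2 : q r = r * B r := by simp only [q, degProfileFlux, B]; ring
    change _ + (θ - 1) * q r * y r = _
    rw [e, e2]
    ring
  have hone : Tendsto
      (fun r => r ^ (1 - θ) * q r ^ 2 + lam * r * y r ^ 2 + (θ - 1) * q r * y r)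
      (𝓝[<] 1) (𝓝 (q 1 ^ 2)) := by
    have hpow : ContinuousAt (fun r : ℝ => r ^ (1 - θ)) 1 :=
      Real.continuousAt_rpow_const _ _ (Or.inl one_ne_zero)
    have hc : ContinuousAt (fun r => r ^ (1 - θ) * q r ^ 2 + lam * r * y r ^ 2 +
        (θ - 1) * q r * y r) 1 := by fun_prop
    have := hc.tendsto
    simp only [h1, Real.one_rpow] at this
    refine Tendsto.mono_left ?_ nhdsWithin_le_nhds
    convert this using 2
    ring
  have := intervalIntegral.integral_eq_sub_of_hasDerivAt_of_tendsto zero_lt_one hder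
    ((continuous_const.mul (hyc.pow 2)).intervalIntegrable _ _) hzero hone
  rwa [intervalIntegral.integral_const_mul, sub_zero] at this

/-- The flux of the bounded solution does not vanish where the solution does. -/
lemma degProfileFlux_one_ne_zero (hθ : θ ∈ Ico (1 : ℝ) 2) (h1 : degProfile θ lam 1 = 0) :
    degProfileFlux θ lam 1 ≠ 0 := by
  intro h2
  have hy : Tendsto (degProfile θ lam) (𝓝[<] 1) (𝓝 0) := by
    rw [← h1]
    exact ((continuous_degProfile hθ.2 lam).tendsto 1).mono_left nhdsWithin_le_nhds
  have hq : Tendsto (degProfileFlux θ lam) (𝓝[<] 1) (𝓝 0) := by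
    rw [← h2]
    exact ((continuous_degProfileFlux hθ.2 lam).tendsto 1).mono_left nhdsWithin_le_nhds
  have hz := (isDegSolution_degProfile hθ lam).eq_zero (by linarith [hθ.1]) hy hq
  have hpos := degProfile_zero_pos hθ.2 lam
  have hev : ∀ᶠ r in 𝓝[>] (0 : ℝ), 0 < degProfile θ lam r :=
    (((continuous_degProfile hθ.2 lam).tendsto 0).mono_left nhdsWithin_le_nhds).eventually
      (lt_mem_nhds hpos)
  obtain ⟨r, hr, hr'⟩ := (hev.and (Ioo_mem_nhdsGT zero_lt_one)).exists
  exact hr.ne' (hz r hr').1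

end Real

/-! ### Hilbert-Schmidt operators are compact -/

section HilbertSchmidt

variable {α H : Type*} [MeasurableSpace α] {m : Measure α} [NormedAddCommGroup H]
  [InnerProductSpace ℝ H]

/-- The operator `f ↦ (t ↦ ⟪f, K t⟫)` attached to a square integrable `H`-valued function `K`. For
`H = L²(β)` this is the Hilbert-Schmidt integral operator with kernel `K`. -/
noncomputable def hilbertSchmidtOp (K : Lp H 2 m) : H →L[ℝ] Lp ℝ 2 m :=
  LinearMap.mkContinuous
    { toFun := fun f => (innerSL ℝ f).compLp K
      map_add' := fun f g => by
        rw [map_add]; exact ContinuousLinearMap.add_compLp _ _ K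
      map_smul' := fun c f => by
        rw [map_smul]; exact ContinuousLinearMap.smul_compLp c _ K } ‖K‖
    fun f => by
      refine ((innerSL ℝ f).norm_compLp_le K).trans ?_
      rw [innerSL_apply_norm, mul_comm]

lemma coeFn_hilbertSchmidtOp (K : Lp H 2 m) (f : H) :
    hilbertSchmidtOp K f =ᵐ[m] fun t => inner ℝ f (K t) :=
  (innerSL ℝ f).coeFn_compLp K

lemma hilbertSchmidtOp_add (K L : Lp H 2 m) :
    hilbertSchmidtOp (K + L) = hilbertSchmidtOp K + hilbertSchmidtOp L := by
  ext1 f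
  exact ((innerSL ℝ f).compLpL 2 m).map_add K L

lemma norm_hilbertSchmidtOp_le (K : Lp H 2 m) : ‖hilbertSchmidtOp K‖ ≤ ‖K‖ :=
  LinearMap.mkContinuous_norm_le _ (norm_nonneg K) _

lemma continuous_hilbertSchmidtOp :
    Continuous (hilbertSchmidtOp : Lp H 2 m → H →L[ℝ] Lp ℝ 2 m) := by
  refine AddMonoidHomClass.continuous_of_bound
    (AddMonoidHom.mk' hilbertSchmidtOp hilbertSchmidtOp_add) 1 fun K => ?_
  rw [one_mul]
  exact norm_hilbertSchmidtOp_le K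

/-- Hilbert-Schmidt operators are compact: for an indicator function `K` the operator has rank one,
such `K` generate a dense subspace, and compact operators are closed. -/
lemma isCompactOperator_hilbertSchmidtOp (K : Lp H 2 m) :
    IsCompactOperator (hilbertSchmidtOp K) := by
  refine Lp.induction (by norm_num)
    (motive := fun K : Lp H 2 m => IsCompactOperator (hilbertSchmidtOp K)) ?_ ?_ ?_ K
  · intro c s hs hμs
    have : (hilbertSchmidtOp (Lp.simpleFunc.indicatorConst 2 hs hμs.ne c : Lp H 2 m) :
        H →L[ℝ] Lp ℝ 2 m) =
        (ContinuousLinearMap.toSpanSingleton ℝ (indicatorConstLp 2 hs hμs.ne (1 : ℝ))).comp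
          (innerSL ℝ c) := by
      ext1 f
      rw [Lp.simpleFunc.coe_indicatorConst]
      refine Lp.ext ((coeFn_hilbertSchmidtOp _ f).trans ?_)
      simp only [ContinuousLinearMap.comp_apply, ContinuousLinearMap.toSpanSingleton_apply,
        innerSL_apply_apply]
      filter_upwards [indicatorConstLp_coeFn (p := 2) (hs := hs) (hμs := hμs.ne) (c := c),
        indicatorConstLp_coeFn (p := 2) (hs := hs) (hμs := hμs.ne) (c := (1 : ℝ)),
        Lp.coeFn_smul (inner ℝ c f) (indicatorConstLp 2 hs hμs.ne (1 : ℝ))] with t h1 h2 h3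
      rw [h1, h3, Pi.smul_apply, h2]
      by_cases ht : t ∈ s <;> simp [ht, real_inner_comm]
    rw [this]
    exact (isCompactOperator_of_locallyCompactSpace_dom
      (innerSL ℝ c)).clm_comp
        (ContinuousLinearMap.toSpanSingleton ℝ (indicatorConstLp 2 hs hμs.ne (1 : ℝ)))
  · intro f g hf hg _ h1 h2
    rw [hilbertSchmidtOp_add]
    exact h1.add h2
  · exact isClosed_setOfPred_isCompactOperator.preimage continuous_hilbertSchmidtOp

end HilbertSchmidt

/-! ### Completeness of the bounded solutions -/

lemma ae_eq_zero_of_forall_integral_eq_zero {f : ℝ → ℝ} (hf : IntervalIntegrable f volume 0 1)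
    (h : ∀ x ∈ Ioo (0 : ℝ) 1, ∫ t in (0 : ℝ)..x, f t = 0) :
    ∀ᵐ x ∂unitMeasure, f x = 0 := by
  rw [ae_restrict_iff' measurableSet_Ioo]
  filter_upwards [hf.ae_hasDerivAt_integral] with x hx hx01
  have hx' : x ∈ uIcc (0 : ℝ) 1 := by
    rw [uIcc_of_le zero_le_one]; exact Ioo_subset_Icc_self hx01
  have h1 := hx hx' 0 left_mem_uIcc
  have h2 : HasDerivAt (fun x => ∫ t in (0 : ℝ)..x, f t) 0 x :=
    (hasDerivAt_const x (0 : ℝ)).congr_of_eventuallyEq <| by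
      filter_upwards [isOpen_Ioo.mem_nhds hx01] with z hz using h z hz
  exact h1.unique h2

/-- The indicator function of `(0, x]` in `L²(0,1)`. -/
noncomputable def initialIndicator (x : ℝ) : Lp ℝ 2 unitMeasure :=
  indicatorConstLp 2 (s := Ioc 0 x) measurableSet_Ioc (measure_ne_top _ _) 1

lemma continuous_initialIndicator : Continuous initialIndicator := by
  refine continuous_indicatorConstLp_set (by norm_num) fun x => ?_
  have h1 : Tendsto (fun y : ℝ => ENNReal.ofReal |y - x|) (𝓝 x) (𝓝 0) := by
    have : Continuous fun y : ℝ => ENNReal.ofReal |y - x| :=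
      ENNReal.continuous_ofReal.comp (by fun_prop)
    simpa using this.tendsto x
  refine tendsto_of_tendsto_of_tendsto_of_le_of_le tendsto_const_nhds h1 (fun _ => zero_le)
    fun y => ?_
  have hsub : symmDiff (Ioc 0 y) (Ioc 0 x) ⊆ uIoc x y := by
    intro t ht
    simp only [Set.mem_symmDiff, mem_Ioc, mem_uIoc] at ht ⊢
    grind
  calc unitMeasure (symmDiff (Ioc 0 y) (Ioc 0 x)) ≤ volume (uIoc x y) :=
        (measure_mono hsub).trans (Measure.restrict_apply_le _ _)
    _ = ENNReal.ofReal |y - x| := by rw [Real.volume_uIoc]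

lemma unitMeasure_real_Ioc {x : ℝ} (hx : x ∈ Ioo (0 : ℝ) 1) : unitMeasure.real (Ioc 0 x) = x := by
  rw [measureReal_restrict_apply measurableSet_Ioc,
    inter_eq_left.2 (show Ioc 0 x ⊆ Ioo 0 1 from fun t ht => ⟨ht.1, ht.2.trans_lt hx.2⟩),
    Real.volume_real_Ioc_of_le hx.1.le,
    sub_zero]

lemma inner_initialIndicator_initialIndicator {x t : ℝ} (hx : x ∈ Ioo (0 : ℝ) 1)
    (ht : t ∈ Ioo (0 : ℝ) 1) :
    inner ℝ (initialIndicator x) (initialIndicator t) = min x t := by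
  rw [initialIndicator, initialIndicator, L2.real_inner_indicatorConstLp_one_indicatorConstLp_one,
    Ioc_inter_Ioc, sup_idem,
    unitMeasure_real_Ioc ⟨lt_min hx.1 ht.1, (min_le_left _ _).trans_lt hx.2⟩]

lemma inner_initialIndicator (u : Lp ℝ 2 unitMeasure) {x : ℝ} (hx : x ∈ Ioo (0 : ℝ) 1) :
    inner ℝ u (initialIndicator x) = ∫ t in (0 : ℝ)..x, u t := by
  rw [real_inner_comm, initialIndicator, L2.inner_indicatorConstLp_one,
    intervalIntegral.integral_of_le hx.1.le, Measure.restrict_restrict measurableSet_Ioc,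
    inter_eq_left.2 (show Ioc 0 x ⊆ Ioo 0 1 from fun t ht => ⟨ht.1, ht.2.trans_lt hx.2⟩)]

lemma inner_initialIndicator_zero (u : Lp ℝ 2 unitMeasure) :
    inner ℝ u (initialIndicator 0) = 0 := by
  rw [real_inner_comm, initialIndicator, L2.inner_indicatorConstLp_one]
  simp

lemma intervalIntegrable_of_memLp {E : Type*} [NormedAddCommGroup E] {u : ℝ → E}
    (hu : MemLp u 2 unitMeasure) : IntervalIntegrable u volume 0 1 := by
  rw [intervalIntegrable_iff_integrableOn_Ioo_of_le zero_le_one]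
  exact hu.integrable one_le_two

/-- The kernel `t ↦ t^{-θ/2} 1_{(0,t]}` of the operator `f ↦ t^{-θ/2} ∫_0^t f`. -/
noncomputable def primitiveKernel (θ t : ℝ) : Lp ℝ 2 unitMeasure :=
  (t ^ (-(θ / 2)) : ℝ) • initialIndicator t

lemma norm_primitiveKernel_sq (θ : ℝ) {t : ℝ} (ht : t ∈ Ioo (0 : ℝ) 1) :
    ‖primitiveKernel θ t‖ ^ 2 = t ^ (1 - θ) := by
  have h1 : ‖initialIndicator t‖ ^ 2 = t := by
    rw [← real_inner_self_eq_norm_sq, inner_initialIndicator_initialIndicator ht ht, min_self]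
  rw [primitiveKernel, norm_smul, mul_pow, h1, Real.norm_eq_abs, sq_abs, ← Real.rpow_natCast,
    ← Real.rpow_mul ht.1.le, ← Real.rpow_add_one ht.1.ne']
  congr 1
  push_cast
  ring

/-- The kernel is square integrable because `t^{1-θ}` is integrable on `(0,1)` for `θ < 2`. -/
lemma memLp_primitiveKernel {θ : ℝ} (hθ : θ < 2) :
    MemLp (primitiveKernel θ) 2 unitMeasure := by
  have hmeas : AEStronglyMeasurable (primitiveKernel θ) unitMeasure := by
    have h1 : Measurable fun t : ℝ => (t ^ (-(θ / 2)) : ℝ) := measurable_id.pow_const _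
    exact (h1.stronglyMeasurable.smul
      continuous_initialIndicator.stronglyMeasurable).aestronglyMeasurable
  rw [memLp_two_iff_integrable_sq_norm hmeas]
  have h2 : IntegrableOn (fun t : ℝ => t ^ (1 - θ)) (Ioo 0 1) :=
    (intervalIntegral.integrableOn_Ioo_rpow_iff one_pos).2 (by linarith)
  refine h2.congr ?_
  filter_upwards [ae_restrict_mem measurableSet_Ioo] with t ht
  exact (norm_primitiveKernel_sq θ ht).symm

/-- The Hilbert-Schmidt operator `f ↦ t^{-θ/2} ∫_0^t f` on `L²(0,1)`. -/
noncomputable def primitiveOp {θ : ℝ} (hθ : θ < 2) : Lp ℝ 2 unitMeasure →L[ℝ] Lp ℝ 2 unitMeasure :=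
  hilbertSchmidtOp (memLp_primitiveKernel hθ).toLp

lemma coeFn_primitiveOp {θ : ℝ} (hθ : θ < 2) (f : Lp ℝ 2 unitMeasure) :
    primitiveOp hθ f =ᵐ[unitMeasure]
      fun t => t ^ (-(θ / 2)) * inner ℝ f (initialIndicator t) := by
  filter_upwards [coeFn_hilbertSchmidtOp (memLp_primitiveKernel hθ).toLp f,
    (memLp_primitiveKernel hθ).coeFn_toLp] with t h1 h2
  rw [primitiveOp, h1, h2, primitiveKernel, inner_smul_right]

lemma inner_primitiveOp_initialIndicator {θ : ℝ} (hθ : θ < 2) (f : Lp ℝ 2 unitMeasure) {x : ℝ}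
    (hx : x ∈ Ioo (0 : ℝ) 1) :
    inner ℝ (primitiveOp hθ f) (primitiveOp hθ (initialIndicator x)) =
      ∫ t in (0 : ℝ)..1, t ^ (-θ) * inner ℝ f (initialIndicator t) * min x t := by
  rw [L2.inner_def, intervalIntegral.integral_of_le zero_le_one, integral_Ioc_eq_integral_Ioo]
  refine integral_congr_ae ?_
  filter_upwards [coeFn_primitiveOp hθ f, coeFn_primitiveOp hθ (initialIndicator x),
    ae_restrict_mem measurableSet_Ioo] with t h1 h2 ht
  rw [h1, h2, inner_initialIndicator_initialIndicator hx ht, RCLike.inner_apply, conj_trivial]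
  have : t ^ (-θ) = t ^ (-(θ / 2)) * t ^ (-(θ / 2)) := by
    rw [← Real.rpow_add ht.1]; congr 1; ring
  rw [this]
  ring

section Calculus

variable {θ : ℝ} {P : ℝ → ℝ}

lemma hasDerivAt_tail_integral (hP : Continuous P) {x : ℝ} (hx : 0 < x) :
    HasDerivAt (fun x : ℝ => ∫ t in x..1, t ^ (-θ) * P t) (-(x ^ (-θ) * P x)) x := by
  have hc : ∀ t : ℝ, 0 < t → ContinuousAt (fun t : ℝ => t ^ (-θ) * P t) t := fun t ht =>
    (Real.continuousAt_rpow_const _ _ (Or.inl ht.ne')).mul hP.continuousAt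
  refine intervalIntegral.integral_hasDerivAt_left ?_ ?_ (hc x hx)
  · refine ContinuousOn.intervalIntegrable fun t ht => (hc t ?_).continuousWithinAt
    exact (lt_min hx one_pos).trans_le ht.1
  · exact ((measurable_id.pow_const _).mul hP.measurable).stronglyMeasurable.stronglyMeasurableAtFilter

lemma integral_mul_min_eq (hθ : θ < 2) (hP : Continuous P) {x : ℝ} (hx : x ∈ Ioo (0 : ℝ) 1) :
    ∫ t in (0 : ℝ)..1, t ^ (-θ) * P t * min x t =
      (∫ t in (0 : ℝ)..x, t ^ (1 - θ) * P t) + x * ∫ t in x..1, t ^ (-θ) * P t := by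
  have e1 : ∀ t ∈ uIoc 0 x, t ^ (1 - θ) * P t = t ^ (-θ) * P t * min x t := by
    intro t ht
    rw [uIoc_of_le hx.1.le] at ht
    rw [min_eq_right ht.2, show 1 - θ = -θ + 1 by ring, Real.rpow_add_one ht.1.ne']
    ring
  have e2 : ∀ t ∈ uIoc x 1, x * (t ^ (-θ) * P t) = t ^ (-θ) * P t * min x t := by
    intro t ht
    rw [uIoc_of_le hx.2.le] at ht
    rw [min_eq_left ht.1.le]
    ring
  have i1 : IntervalIntegrable (fun t => t ^ (1 - θ) * P t) volume 0 x :=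
    (intervalIntegral.intervalIntegrable_rpow' (by linarith)).mul_continuousOn hP.continuousOn
  have i2 : IntervalIntegrable (fun t => x * (t ^ (-θ) * P t)) volume x 1 := by
    refine ContinuousOn.intervalIntegrable fun t ht => ContinuousAt.continuousWithinAt ?_
    have ht0 : 0 < t := (lt_min hx.1 one_pos).trans_le ht.1
    exact continuousAt_const.mul
      ((Real.continuousAt_rpow_const _ _ (Or.inl ht0.ne')).mul hP.continuousAt)
  rw [← intervalIntegral.integral_const_mul,
    ← intervalIntegral.integral_add_adjacent_intervals (b := x) (i1.congr e1) (i2.congr e2),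
    intervalIntegral.integral_congr_ae (Eventually.of_forall e1),
    intervalIntegral.integral_congr_ae (Eventually.of_forall e2)]

/-- The derivative of `x ↦ ∫_0^1 t^{-θ} P(t) min(x,t) dt`: only the part over `(x, 1)` depends on
`x` to first order. -/
lemma hasDerivAt_integral_mul_min (hθ : θ < 2) (hP : Continuous P) {x : ℝ}
    (hx : x ∈ Ioo (0 : ℝ) 1) :
    HasDerivAt (fun x => ∫ t in (0 : ℝ)..1, t ^ (-θ) * P t * min x t)
      (∫ t in x..1, t ^ (-θ) * P t) x := by
  have h1 : HasDerivAt (fun x : ℝ => ∫ t in (0 : ℝ)..x, t ^ (1 - θ) * P t)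
      (x ^ (1 - θ) * P x) x := by
    refine intervalIntegral.integral_hasDerivAt_right
      ((intervalIntegral.intervalIntegrable_rpow' (by linarith)).mul_continuousOn
        hP.continuousOn) ?_ ?_
    · exact ((measurable_id.pow_const _).mul
        hP.measurable).stronglyMeasurable.stronglyMeasurableAtFilter
    · exact (Real.continuousAt_rpow_const _ _ (Or.inl hx.1.ne')).mul hP.continuousAt
  have h2 := h1.add ((hasDerivAt_id x).mul (hasDerivAt_tail_integral (θ := θ) hP hx.1))
  refine (h2.congr_deriv ?_).congr_of_eventuallyEq ?_
  · rw [show 1 - θ = -θ + 1 by ring, Real.rpow_add_one hx.1.ne']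
    simp only [id]
    ring
  · filter_upwards [isOpen_Ioo.mem_nhds hx] with z hz using integral_mul_min_eq hθ hP hz

lemma tendsto_tail_integral (hP : Continuous P) :
    Tendsto (fun x : ℝ => ∫ t in x..1, t ^ (-θ) * P t) (𝓝[<] 1) (𝓝 0) := by
  have := (hasDerivAt_tail_integral (θ := θ) hP one_pos).continuousAt.tendsto
  rw [intervalIntegral.integral_same] at this
  exact this.mono_left nhdsWithin_le_nhds

end Calculus

section Completeness

variable {θ : ℝ}

lemma inner_eq_zero_of_integral_eq_zero (u : Lp ℝ 2 unitMeasure)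
    (h : ∀ x ∈ Ioo (0 : ℝ) 1, inner ℝ u (initialIndicator x) = 0) : u = 0 := by
  have h1 := ae_eq_zero_of_forall_integral_eq_zero (intervalIntegrable_of_memLp (Lp.memLp u))
    fun x hx => (inner_initialIndicator u hx).symm.trans (h x hx)
  exact (Lp.eq_zero_iff_ae_eq_zero).2 h1

/-- The classification of the eigenvectors of `S† S`, `S = primitiveOp`. For an eigenvector `u`
with eigenvalue `m`, the pair `(Q / m, -P / m)` with `P(x) = ∫_0^x u` and
`Q(x) = ∫_x^1 t^{-θ} P(t) dt` is a solution for `λ = 1 / m` in the sense of `IsDegSolution`. By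
Green's formula either `y_λ(1) = 0`, and then `u` is a multiple of `y_λ`, or `P(1) = 0`, and then
`u = 0` by uniqueness at the regular endpoint. -/
lemma inner_eigenvector_eq_zero (hθ : θ ∈ Ico (1 : ℝ) 2) {u g : Lp ℝ 2 unitMeasure} {m : ℝ}
    (hu : ∀ v, inner ℝ (primitiveOp hθ.2 u) (primitiveOp hθ.2 v) = m * inner ℝ u v)
    (hg : ∀ lam : ℝ, 0 < lam → degProfile θ lam 1 = 0 →
      ∫ r in (0 : ℝ)..1, degProfile θ lam r * g r = 0) :
    inner ℝ u g = 0 := by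
  by_cases hu0 : u = 0
  · rw [hu0, inner_zero_left]
  set P : ℝ → ℝ := fun x => inner ℝ u (initialIndicator x)
  have hP : Continuous P := continuous_const.inner continuous_initialIndicator
  have hPzero : P 0 = 0 := inner_initialIndicator_zero u
  set Q : ℝ → ℝ := fun x => ∫ t in x..1, t ^ (-θ) * P t
  have hQ' : ∀ x, 0 < x → HasDerivAt Q (-(x ^ (-θ) * P x)) x := fun x hx =>
    hasDerivAt_tail_integral hP hx
  have hQ1 : Tendsto Q (𝓝[<] 1) (𝓝 0) := tendsto_tail_integral hP
  have hmP : ∀ x ∈ Ioo (0 : ℝ) 1, HasDerivAt (fun x => m * P x) (Q x) x := by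
    intro x hx
    refine (hasDerivAt_integral_mul_min hθ.2 hP hx).congr_of_eventuallyEq ?_
    filter_upwards [isOpen_Ioo.mem_nhds hx] with z hz
    exact (hu (initialIndicator z)).symm.trans (inner_primitiveOp_initialIndicator hθ.2 u hz)
  have hm0 : m ≠ 0 := by
    intro hm
    refine hu0 (inner_eq_zero_of_integral_eq_zero u fun x hx => ?_)
    have hQ0 : ∀ x ∈ Ioo (0 : ℝ) 1, Q x = 0 := fun x hx => by
      have h1 := hmP x hx
      simp only [hm, zero_mul] at h1
      exact h1.unique (hasDerivAt_const x 0)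
    have h2 : HasDerivAt Q 0 x := (hasDerivAt_const x (0 : ℝ)).congr_of_eventuallyEq <| by
      filter_upwards [isOpen_Ioo.mem_nhds hx] with z hz using hQ0 z hz
    have h3 := (hQ' x hx.1).unique h2
    exact (mul_eq_zero.1 (neg_eq_zero.1 h3)).resolve_left (Real.rpow_pos_of_pos hx.1 _).ne'
  have hm : 0 < m := by
    have h1 := hu u
    rw [real_inner_self_eq_norm_sq, real_inner_self_eq_norm_sq] at h1
    have h2 : 0 < ‖u‖ := norm_pos_iff.2 hu0
    refine lt_of_le_of_ne ?_ hm0.symm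
    by_contra! hneg
    nlinarith [sq_nonneg ‖primitiveOp hθ.2 u‖, mul_pos h2 h2]
  set lam : ℝ := 1 / m
  have hlam : 0 < lam := one_div_pos.2 hm
  have hP' : ∀ x ∈ Ioo (0 : ℝ) 1, HasDerivAt P (lam * Q x) x := by
    intro x hx
    have := (hmP x hx).const_mul lam
    simpa only [lam, ← mul_assoc, one_div_mul_cancel hm0, one_mul] using this
  have hsol : IsDegSolution θ lam (fun x => lam * Q x) (fun x => -(lam * P x)) := by
    refine ⟨fun x hx => ?_, fun x hx => ?_⟩
    · refine ((hQ' x hx.1).const_mul lam).congr_deriv ?_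
      rw [smul_eq_mul]; ring
    · exact ((hP' x hx).const_mul lam).neg
  have hp0 : Tendsto (fun x => -(lam * P x)) (𝓝[>] 0) (𝓝 0) := by
    have h1 : Continuous fun x => -(lam * P x) := (continuous_const.mul hP).neg
    simpa [hPzero] using (h1.tendsto 0).mono_left (nhdsWithin_le_nhds (s := Ioi 0))
  have hp1 : Tendsto (fun x => -(lam * P x)) (𝓝[<] 1) (𝓝 (-(lam * P 1))) :=
    ((continuous_const.mul hP).neg.tendsto 1).mono_left nhdsWithin_le_nhds
  have hQl : Tendsto (fun x => lam * Q x) (𝓝[<] 1) (𝓝 0) := by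
    simpa using hQ1.const_mul lam
  set y := degProfile θ lam
  set q := degProfileFlux θ lam
  have hyc : Continuous y := continuous_degProfile hθ.2 lam
  have hqc : Continuous q := continuous_degProfileFlux hθ.2 lam
  have hy1 := (hyc.tendsto 1).mono_left (nhdsWithin_le_nhds (s := Iio 1))
  have hq1 := (hqc.tendsto 1).mono_left (nhdsWithin_le_nhds (s := Iio 1))
  -- `P' = λ Q` is an `L²` function, since it agrees with `u` almost everywhere
  have huQ : ∀ᵐ x ∂unitMeasure, u x = lam * Q x := by
    have hint := intervalIntegrable_of_memLp (Lp.memLp u)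
    rw [ae_restrict_iff' measurableSet_Ioo]
    filter_upwards [hint.ae_hasDerivAt_integral] with x hx hx01
    have hx' : x ∈ uIcc (0 : ℝ) 1 := by
      rw [uIcc_of_le zero_le_one]; exact Ioo_subset_Icc_self hx01
    refine (hx hx' 0 left_mem_uIcc).unique ((hP' x hx01).congr_of_eventuallyEq ?_)
    filter_upwards [isOpen_Ioo.mem_nhds hx01] with z hz
    exact (inner_initialIndicator u hz).symm
  have hQint : IntervalIntegrable (fun x => lam * Q x) volume 0 1 := by
    rw [intervalIntegrable_iff_integrableOn_Ioo_of_le zero_le_one]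
    exact ((Lp.memLp u).integrable one_le_two).congr huQ
  have hgreen := hsol.green hθ hp0 hQint lam ((hq1.smul hQl).sub (hy1.smul hp1))
  have hyP : y 1 * P 1 = 0 := by
    have h1 : 0 = q 1 * 0 - y 1 * -(lam * P 1) := by simpa using hgreen
    have h2 : lam * (y 1 * P 1) = 0 := by linarith
    exact (mul_eq_zero.1 h2).resolve_left hlam.ne'
  rcases mul_eq_zero.1 hyP with hy | hP1
  · have hqne : q 1 ≠ 0 := degProfileFlux_one_ne_zero hθ hy
    set c : ℝ := -(lam * P 1) / q 1
    have hsol2 : IsDegSolution θ lam (fun x => lam * Q x - c * y x)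
        (fun x => -(lam * P x) - c * q x) := by
      have hs := isDegSolution_degProfile hθ lam
      refine ⟨fun x hx => ?_, fun x hx => ?_⟩
      · refine ((hsol.hasDerivAt x hx).sub ((hs.hasDerivAt x hx).const_mul c)).congr_deriv ?_
        simp only [smul_eq_mul, q]
        ring
      · refine ((hsol.hasDerivAt_flux x hx).sub
          ((hs.hasDerivAt_flux x hx).const_mul c)).congr_deriv ?_
        simp only [y]
        ring
    have hz := hsol2.eq_zero (by linarith [hθ.1])
      (by simpa [hy] using hQl.sub (hy1.const_mul c))
      (by
        have := hp1.sub (hq1.const_mul c)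
        rwa [div_mul_cancel₀ _ hqne, sub_self] at this)
    have hug : inner ℝ u g = c * ∫ r in (0 : ℝ)..1, y r * g r := by
      rw [L2.inner_def, ← intervalIntegral.integral_const_mul,
        intervalIntegral.integral_of_le zero_le_one, integral_Ioc_eq_integral_Ioo]
      refine integral_congr_ae ?_
      filter_upwards [huQ, ae_restrict_mem measurableSet_Ioo] with x hx hx01
      rw [RCLike.inner_apply, conj_trivial, hx, sub_eq_zero.1 (hz x hx01).1]
      ring
    rw [hug, hg lam hlam hy, mul_zero]
  · have hz := hsol.eq_zero (by linarith [hθ.1]) hQl (by simpa [hP1] using hp1)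
    refine absurd (inner_eq_zero_of_integral_eq_zero u fun x hx => ?_) hu0
    have := (hz x hx).2
    simpa [hlam.ne'] using this

/-- The bounded solutions with a Dirichlet condition at `1` are complete in `L²(0,1)`, by the
spectral theorem for the compact self-adjoint operator `S† S`, `S = primitiveOp`. -/
theorem ae_eq_zero_of_forall_integral_degProfile_eq_zero (hθ : θ ∈ Ico (1 : ℝ) 2) {g : ℝ → ℝ}
    (hg : MemLp g 2 unitMeasure)
    (h : ∀ lam : ℝ, 0 < lam → degProfile θ lam 1 = 0 →
      ∫ r in (0 : ℝ)..1, degProfile θ lam r * g r = 0) :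
    g =ᵐ[unitMeasure] 0 := by
  set S := primitiveOp hθ.2
  set T := ContinuousLinearMap.adjoint S ∘L S
  have hT : IsCompactOperator T :=
    (isCompactOperator_hilbertSchmidtOp _).clm_comp (ContinuousLinearMap.adjoint S)
  have hTi : ∀ f v, inner ℝ (T f) v = inner ℝ (S f) (S v) := fun f v => by
    rw [ContinuousLinearMap.comp_apply, ContinuousLinearMap.adjoint_inner_left]
  have hTs : T.IsSymmetric := fun f v => by
    change inner ℝ (T f) v = inner ℝ f (T v)
    rw [hTi, ← real_inner_comm f, hTi, real_inner_comm]
  have hbot := ContinuousLinearMap.orthogonalComplement_iSup_eigenspaces_eq_bot hT hTs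
  have hmem : hg.toLp ∈
      (⨆ μ, Module.End.eigenspace (T : Module.End ℝ (Lp ℝ 2 unitMeasure)) μ)ᗮ := by
    rw [← Submodule.iInf_orthogonal, Submodule.mem_iInf]
    intro m
    rw [Submodule.mem_orthogonal]
    intro u hu
    refine inner_eigenvector_eq_zero hθ (m := m) (fun v => ?_) fun lam hlam hy => ?_
    · have hu' : T u = m • u := Module.End.mem_eigenspace_iff.1 hu
      rw [← hTi, hu', inner_smul_left]
      simp
    · refine Eq.trans ?_ (h lam hlam hy)
      simp only [intervalIntegral.integral_of_le zero_le_one, integral_Ioc_eq_integral_Ioo]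
      refine integral_congr_ae ?_
      filter_upwards [hg.coeFn_toLp] with r hr
      rw [hr]
  rw [hbot, Submodule.mem_bot] at hmem
  exact hg.coeFn_toLp.symm.trans (Lp.eq_zero_iff_ae_eq_zero.1 hmem)

end Completeness

/-! ### Zeros of the Bessel function -/

lemma memLp_unitMeasure_of_continuous {E : Type*} [NormedAddCommGroup E] {f : ℝ → E}
    (hf : Continuous f) {p : ENNReal} : MemLp f p unitMeasure := by
  obtain ⟨C, hC⟩ := isCompact_Icc.exists_bound_of_continuousOn (s := Icc (0 : ℝ) 1) hf.continuousOn
  refine MemLp.of_bound hf.aestronglyMeasurable C ?_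
  filter_upwards [ae_restrict_mem measurableSet_Ioo] with x hx using hC x (Ioo_subset_Icc_self hx)

section Zeros

variable {θ : ℝ}

lemma degExp_pos (hθ : θ < 2) : 0 < degExp θ := by
  rw [degExp]; linarith

lemma degProfile_degExp_sq_mul (hθ : θ < 2) (z r : ℝ) :
    degProfile θ (degExp θ ^ 2 * z ^ 2) r =
      besselEntire (degOrder θ) (z ^ 2 * r ^ (2 - θ) / 4) := by
  have h : 2 - θ ≠ 0 := by linarith
  rw [degProfile, degExp]
  congr 1
  field_simp
  ring

lemma degProfileFlux_degExp_sq_mul (hθ : θ < 2) (z r : ℝ) :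
    degProfileFlux θ (degExp θ ^ 2 * z ^ 2) r =
      -(degExp θ * z ^ 2 / 2) * r * besselEntire (degOrder θ + 1) (z ^ 2 * r ^ (2 - θ) / 4) := by
  have h : 2 - θ ≠ 0 := by linarith
  have e : degExp θ ^ 2 * z ^ 2 * r ^ (2 - θ) / (2 - θ) ^ 2 = z ^ 2 * r ^ (2 - θ) / 4 := by
    rw [degExp]; field_simp; ring
  rw [degProfileFlux, e, degExp]
  congr 2
  field_simp

lemma degProfile_one_eq_zero_iff (hθ : θ < 2) {z : ℝ} (hz : 0 < z) :
    degProfile θ (degExp θ ^ 2 * z ^ 2) 1 = 0 ↔ besselJ (degOrder θ) z = 0 := by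
  rw [degProfile_degExp_sq_mul hθ, besselJ_eq_zero_iff hz, Real.one_rpow, mul_one]

lemma exists_eq_degExp_sq_mul (hθ : θ < 2) {lam : ℝ} (hlam : 0 < lam) :
    ∃ z, 0 < z ∧ lam = degExp θ ^ 2 * z ^ 2 := by
  have h := degExp_pos hθ
  refine ⟨√lam / degExp θ, by positivity, ?_⟩
  rw [div_pow, Real.sq_sqrt hlam.le]
  field_simp

lemma besselEntire_succ_ne_zero (hθ : θ ∈ Ico (1 : ℝ) 2) {z : ℝ} (hz : 0 < z)
    (h : besselJ (degOrder θ) z = 0) : besselEntire (degOrder θ + 1) (z ^ 2 / 4) ≠ 0 := by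
  have h1 := degProfileFlux_one_ne_zero hθ ((degProfile_one_eq_zero_iff hθ.2 hz).2 h)
  rw [degProfileFlux_degExp_sq_mul hθ.2, Real.one_rpow, mul_one, mul_one] at h1
  exact right_ne_zero_of_mul h1

/-- `J_ν` has finitely many zeros in each `(0, M]`: they are simple, hence isolated, and they do not
accumulate at `0` because `F_ν(0) ≠ 0`. -/
lemma finite_besselJ_zeros_le (hθ : θ ∈ Ico (1 : ℝ) 2) (M : ℝ) :
    {z : ℝ | (0 < z ∧ besselJ (degOrder θ) z = 0) ∧ z ≤ M}.Finite := by
  have hν := degOrder_nonneg hθ.2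
  set G : ℝ → ℝ := fun z => besselEntire (degOrder θ) (z ^ 2 / 4)
  have hG : Continuous G := (continuous_besselEntire hν).comp (by fun_prop)
  by_contra hinf
  obtain ⟨x, hx, hacc⟩ := Set.Infinite.exists_accPt_of_subset_isCompact hinf
    (isCompact_Icc (a := 0) (b := M)) fun z hz => ⟨hz.1.1.le, hz.2⟩
  rw [accPt_iff_frequently_nhdsNE] at hacc
  have hfreq : ∃ᶠ z in 𝓝[≠] x, G z = 0 :=
    hacc.mono fun z hz => (besselJ_eq_zero_iff hz.1.1).1 hz.1.2
  have hGx : G x = 0 := by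
    by_contra hne
    have h1 : ∀ᶠ z in 𝓝[≠] x, G z ≠ 0 :=
      (hG.continuousAt.eventually_ne hne).filter_mono nhdsWithin_le_nhds
    obtain ⟨z, h2, h3⟩ := (hfreq.and_eventually h1).exists
    exact h3 h2
  rcases hx.1.eq_or_lt with h0 | h0
  · have := besselEntire_zero_pos hν
    rw [← h0] at hGx
    simp only [G] at hGx
    norm_num at hGx
    linarith
  · have h2 : HasDerivAt (fun x : ℝ => x ^ 2 / 4) (2 * x / 4) x := by
      simpa using (hasDerivAt_pow 2 x).div_const 4
    have h3 : HasDerivAt G (-besselEntire (degOrder θ + 1) (x ^ 2 / 4) * (2 * x / 4)) x :=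
      HasDerivAt.comp (h₂ := besselEntire (degOrder θ)) x
        (hasDerivAt_besselEntire hν (x ^ 2 / 4)) h2
    have h4 : -besselEntire (degOrder θ + 1) (x ^ 2 / 4) * (2 * x / 4) ≠ 0 :=
      mul_ne_zero (neg_ne_zero.2 (besselEntire_succ_ne_zero hθ h0 ((besselJ_eq_zero_iff h0).2 hGx)))
        (by positivity)
    obtain ⟨z, h5, h6⟩ := (hfreq.and_eventually (h3.eventually_ne (c := 0) h4)).exists
    exact h6 h5

/-- `J_ν` has infinitely many positive zeros: otherwise some nonzero polynomial would be orthogonal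
to the finitely many solutions `y_λ` with `y_λ(1) = 0`, against their completeness. -/
lemma infinite_besselJ_zeros (hθ : θ ∈ Ico (1 : ℝ) 2) :
    {z : ℝ | 0 < z ∧ besselJ (degOrder θ) z = 0}.Infinite := by
  intro hfin
  set Z := {z : ℝ | 0 < z ∧ besselJ (degOrder θ) z = 0}
  have : Finite Z := hfin
  have hint : ∀ (lam : ℝ) (p : Polynomial ℝ),
      IntervalIntegrable (fun r => degProfile θ lam r * p.eval r) volume 0 1 := fun lam p =>
    ((continuous_degProfile hθ.2 lam).mul p.continuous).intervalIntegrable _ _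
  let L : Polynomial ℝ →ₗ[ℝ] (Z → ℝ) :=
    { toFun := fun p z => ∫ r in (0 : ℝ)..1, degProfile θ (degExp θ ^ 2 * z.1 ^ 2) r * p.eval r
      map_add' := fun p q => by
        ext z
        simp only [Polynomial.eval_add, mul_add, Pi.add_apply]
        exact intervalIntegral.integral_add (hint _ p) (hint _ q)
      map_smul' := fun c p => by
        ext z
        simp only [Polynomial.eval_smul, smul_eq_mul, Pi.smul_apply, RingHom.id_apply]
        rw [← intervalIntegral.integral_const_mul]
        congr 1
        ext r
        ring }
  have hninj : ¬ Function.Injective L := fun hinj =>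
    Polynomial.not_finite (Module.Finite.of_injective L hinj)
  rw [← LinearMap.ker_eq_bot, Submodule.eq_bot_iff] at hninj
  push Not at hninj
  obtain ⟨p, hp, hp0⟩ := hninj
  have hmem : MemLp (fun r => p.eval r) 2 unitMeasure :=
    memLp_unitMeasure_of_continuous p.continuous
  have hae := ae_eq_zero_of_forall_integral_degProfile_eq_zero hθ hmem fun lam hlam hy => by
    obtain ⟨z, hz, rfl⟩ := exists_eq_degExp_sq_mul hθ.2 hlam
    exact congrFun (LinearMap.mem_ker.1 hp) ⟨z, hz, (degProfile_one_eq_zero_iff hθ.2 hz).1 hy⟩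
  have hEq : EqOn (fun r => p.eval r) 0 (Ioo (0 : ℝ) 1) :=
    Measure.eqOn_open_of_ae_eq hae isOpen_Ioo p.continuous.continuousOn continuousOn_const
  refine hp0 (Polynomial.eq_zero_of_infinite_isRoot p ?_)
  exact (Ioo_infinite zero_lt_one).mono fun r hr => hEq hr

lemma isLeast_sInf_besselJ_zeros (hθ : θ ∈ Ico (1 : ℝ) 2) {t : ℝ} (ht : 0 ≤ t) :
    IsLeast {z : ℝ | t < z ∧ besselJ (degOrder θ) z = 0}
      (sInf {z : ℝ | t < z ∧ besselJ (degOrder θ) z = 0}) := by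
  obtain ⟨M, hM, hM'⟩ := (infinite_besselJ_zeros hθ).exists_notMem_finite
    (finite_besselJ_zeros_le hθ t)
  have htM : t < M := by
    by_contra! hle
    exact hM' ⟨hM, hle⟩
  have hfin : {z : ℝ | (t < z ∧ besselJ (degOrder θ) z = 0) ∧ z ≤ M}.Finite :=
    (finite_besselJ_zeros_le hθ M).subset fun z hz => ⟨⟨ht.trans_lt hz.1.1, hz.1.2⟩, hz.2⟩
  obtain ⟨m, hm, hmin⟩ := hfin.exists_minimalFor id _ ⟨M, ⟨htM, hM.2⟩, le_rfl⟩
  have hleast : IsLeast {z : ℝ | t < z ∧ besselJ (degOrder θ) z = 0} m := by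
    refine ⟨hm.1, fun z hz => ?_⟩
    rcases le_total z m with h | h
    · exact hmin ⟨hz, h.trans hm.2⟩ h
    · exact h
  rwa [hleast.csInf_eq]

lemma besselZero_isLeast (hθ : θ ∈ Ico (1 : ℝ) 2) (n : ℕ) :
    0 < besselZero (degOrder θ) n ∧
      IsLeast {z : ℝ | besselZero (degOrder θ) n < z ∧ besselJ (degOrder θ) z = 0}
        (besselZero (degOrder θ) (n + 1)) := by
  induction n with
  | zero =>
    have h0 : 0 < besselZero (degOrder θ) 0 := (isLeast_sInf_besselJ_zeros hθ le_rfl).1.1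
    exact ⟨h0, isLeast_sInf_besselJ_zeros hθ h0.le⟩
  | succ n ih =>
    have h0 : 0 < besselZero (degOrder θ) (n + 1) := ih.1.trans ih.2.1.1
    exact ⟨h0, isLeast_sInf_besselJ_zeros hθ h0.le⟩

lemma besselZero_pos (hθ : θ ∈ Ico (1 : ℝ) 2) (n : ℕ) : 0 < besselZero (degOrder θ) n :=
  (besselZero_isLeast hθ n).1

lemma besselJ_besselZero (hθ : θ ∈ Ico (1 : ℝ) 2) (n : ℕ) :
    besselJ (degOrder θ) (besselZero (degOrder θ) n) = 0 := by
  cases n with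
  | zero => exact (isLeast_sInf_besselJ_zeros hθ le_rfl).1.2
  | succ n => exact (besselZero_isLeast hθ n).2.1.2

lemma strictMono_besselZero (hθ : θ ∈ Ico (1 : ℝ) 2) : StrictMono (besselZero (degOrder θ)) :=
  strictMono_nat_of_lt_succ fun n => (besselZero_isLeast hθ n).2.1.1

lemma range_besselZero (hθ : θ ∈ Ico (1 : ℝ) 2) :
    range (besselZero (degOrder θ)) = {z : ℝ | 0 < z ∧ besselJ (degOrder θ) z = 0} := by
  refine Subset.antisymm ?_ fun z hz => ?_
  · rintro _ ⟨n, rfl⟩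
    exact ⟨besselZero_pos hθ n, besselJ_besselZero hθ n⟩
  · by_contra hnot
    have hlt : ∀ n, besselZero (degOrder θ) n < z := by
      intro n
      induction n with
      | zero =>
        exact lt_of_le_of_ne ((isLeast_sInf_besselJ_zeros hθ le_rfl).2 hz)
          fun h => hnot ⟨0, h⟩
      | succ n ih =>
        exact lt_of_le_of_ne ((besselZero_isLeast hθ n).2.2 ⟨ih, hz.2⟩) fun h => hnot ⟨n + 1, h⟩
    refine infinite_range_of_injective (strictMono_besselZero hθ).injective
      ((finite_besselJ_zeros_le hθ z).subset ?_)
    rintro _ ⟨n, rfl⟩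
    exact ⟨⟨besselZero_pos hθ n, besselJ_besselZero hθ n⟩, (hlt n).le⟩

end Zeros

/-! ### Classical and weak eigenfunctions -/

section AbsolutelyContinuous

variable {𝕜 : Type*} [RCLike 𝕜] {f f' : ℝ → 𝕜}

lemma absolutelyContinuousOnInterval_of_hasDerivAt {b c : ℝ}
    (hf : ∀ x ∈ uIcc b c, HasDerivAt f (f' x) x) (hf' : ContinuousOn f' (uIcc b c)) :
    AbsolutelyContinuousOnInterval f b c := by
  obtain ⟨C, hC⟩ := isCompact_uIcc.exists_bound_of_continuousOn hf'
  have hlip : LipschitzOnWith C.toNNReal f (uIcc b c) :=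
    Convex.lipschitzOnWith_of_nnnorm_hasDerivWithin_le (convex_uIcc b c)
      (fun x hx => (hf x hx).hasDerivWithinAt)
      (fun x hx => by
        rw [← NNReal.coe_le_coe, Real.coe_toNNReal _ ((norm_nonneg _).trans (hC x hx))]
        exact hC x hx)
  exact hlip.absolutelyContinuousOnInterval

/-- An absolutely continuous function whose a.e. derivative agrees with a continuous function is
continuously differentiable. -/
lemma hasDerivAt_of_absolutelyContinuousOnInterval {α β : ℝ} {g : ℝ → 𝕜}
    (hf : ∀ b ∈ Ioo α β, ∀ c ∈ Ioo α β, AbsolutelyContinuousOnInterval f b c)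
    (hg : ContinuousOn g (Ioo α β)) (hfg : ∀ᵐ x, x ∈ Ioo α β → deriv f x = g x) :
    ∀ x ∈ Ioo α β, HasDerivAt f (g x) x := by
  intro x hx
  obtain ⟨b, hb⟩ := exists_between hx.1
  obtain ⟨c, hc⟩ := exists_between hx.2
  have hbI : b ∈ Ioo α β := ⟨hb.1, hb.2.trans hx.2⟩
  have hcI : c ∈ Ioo α β := ⟨hx.1.trans hc.1, hc.2⟩
  have hbc : b ≤ c := (hb.2.trans hc.1).le
  have hsub : uIcc b c ⊆ Ioo α β := ordConnected_Ioo.uIcc_subset hbI hcI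
  have hprim : ∀ z ∈ uIcc b c, HasDerivAt (fun z => ∫ t in b..z, g t) (g z) z := fun z hz => by
    have hzI := hsub hz
    refine intervalIntegral.integral_hasDerivAt_right ?_ ?_
      (hg.continuousAt (isOpen_Ioo.mem_nhds hzI))
    · exact (hg.mono (ordConnected_Ioo.uIcc_subset hbI hzI)).intervalIntegrable
    · exact hg.stronglyMeasurableAtFilter isOpen_Ioo z hzI
  have hac := (hf b hbI c hcI).sub
    (absolutelyContinuousOnInterval_of_hasDerivAt hprim (hg.mono hsub))
  obtain ⟨C, hC⟩ := hac.const_of_ae_hasDerivAt_zero <| by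
    filter_upwards [(hf b hbI c hcI).boundedVariationOn.ae_differentiableAt_of_mem_uIcc, hfg]
      with z h1 h2 hz
    have h3 := (h1 hz).hasDerivAt.sub (hprim z hz)
    rwa [h2 (hsub hz), sub_self] at h3
  have hxbc : x ∈ uIcc b c := by rw [uIcc_of_le hbc]; exact ⟨hb.2.le, hc.1.le⟩
  refine ((hprim x hxbc).const_add C).congr_of_eventuallyEq ?_
  filter_upwards [Ioo_mem_nhds hb.2 hc.1] with z hz
  have := hC z (by rw [uIcc_of_le hbc]; exact Ioo_subset_Icc_self hz)
  rw [← this]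
  simp

end AbsolutelyContinuous

section Affine

lemma map_affine_volume (a : ℝ) {σ : ℝ} (hσ : σ ≠ 0) :
    Measure.map (fun r : ℝ => a + σ * r) volume = ENNReal.ofReal |σ⁻¹| • volume := by
  have h := Measure.map_map (μ := (volume : Measure ℝ)) (measurable_const_add a)
    (measurable_const_mul σ)
  rw [Real.map_volume_mul_left hσ, Measure.map_smul, (measurePreserving_add_left volume a).map_eq]
    at h
  exact h.symm

lemma measurableEmbedding_affine (a : ℝ) {σ : ℝ} (hσ : σ ≠ 0) :
    MeasurableEmbedding fun r : ℝ => a + σ * r :=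
  ((Homeomorph.mulLeft₀ σ hσ).trans (Homeomorph.addLeft a)).measurableEmbedding

lemma ae_affine_iff (a : ℝ) {σ : ℝ} (hσ : σ ≠ 0) {p : ℝ → Prop} :
    (∀ᵐ r : ℝ, p (a + σ * r)) ↔ ∀ᵐ x : ℝ, p x := by
  have hc : ENNReal.ofReal |σ⁻¹| ≠ 0 := by
    rw [ENNReal.ofReal_ne_zero_iff]; positivity
  have h := Measure.ae_ennreal_smul_measure_iff (p := p) (μ := (volume : Measure ℝ)) hc
  rw [← map_affine_volume a hσ, (measurableEmbedding_affine a hσ).ae_map_iff] at h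
  exact h

lemma affine_mem_Ioo {a σ r : ℝ} (ha : a ∈ Ioo (0 : ℝ) 1) (hσ : a + σ ∈ Icc (0 : ℝ) 1)
    (hr : r ∈ Ioo (0 : ℝ) 1) : a + σ * r ∈ Ioo (0 : ℝ) 1 := by
  constructor
  · nlinarith [mul_nonneg hr.1.le hσ.1, mul_pos ha.1 (sub_pos.2 hr.2)]
  · nlinarith [mul_nonneg hr.1.le (sub_nonneg.2 hσ.2), mul_pos (sub_pos.2 ha.2) (sub_pos.2 hr.2)]

lemma memLp_comp_affine {E : Type*} [NormedAddCommGroup E] {f : ℝ → E} {q : ENNReal} {a σ : ℝ}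
    (ha : a ∈ Ioo (0 : ℝ) 1) (hσ : a + σ ∈ Icc (0 : ℝ) 1) (hσ0 : σ ≠ 0)
    (hf : MemLp f q unitMeasure) : MemLp (fun r => f (a + σ * r)) q unitMeasure := by
  have hemb := measurableEmbedding_affine a hσ0
  have h1 : MemLp f q ((Measure.map (fun r : ℝ => a + σ * r) volume).restrict (Ioo 0 1)) := by
    rw [map_affine_volume a hσ0, Measure.restrict_smul]
    exact hf.smul_measure ENNReal.ofReal_ne_top
  rw [hemb.restrict_map, hemb.memLp_map_measure_iff] at h1
  exact h1.mono_measure (Measure.restrict_mono (fun r hr => affine_mem_Ioo ha hσ hr) le_rfl)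

end Affine

section Eigenpair

variable {𝕜 : Type*} [RCLike 𝕜] {a θ : ℝ} {μ : 𝕜} {φ ψ : ℝ → 𝕜}

lemma ae_ne_unitMeasure (a : ℝ) : ∀ᵐ x ∂unitMeasure, x ≠ a :=
  ae_restrict_of_ae (Measure.ae_ne volume a)

/-- A function that solves the equation classically off the degenerate point, with a flux of order
`|x - a|`, is an eigenfunction in the weak sense. -/
lemma isEigenpair_of_hasDerivAt (hθ : θ < 2)
    (hφ : ∀ x, x ≠ a → HasDerivAt φ ((|x - a| ^ (-θ) : ℝ) • ψ x) x)
    (hψ : ∀ x, x ≠ a → HasDerivAt ψ (-(μ * φ x)) x)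
    {C : ℝ} (hbound : ∀ x ∈ Ioo (0 : ℝ) 1, ‖ψ x‖ ≤ C * |x - a|)
    (hLp : MemLp φ 2 unitMeasure) (h0 : φ 0 = 0) (h1 : φ 1 = 0)
    (hne : ¬ φ =ᵐ[unitMeasure] 0) (ha : a ∈ Ioo (0 : ℝ) 1) : IsEigenpair a θ μ φ := by
  have hpos : ∀ x, x ≠ a → 0 < |x - a| := fun x hx => abs_pos.2 (sub_ne_zero.2 hx)
  have hflux : ∀ x, x ≠ a → degFlux a θ φ x = ψ x := fun x hx => by
    rw [degFlux, (hφ x hx).deriv, smul_smul, ← Real.rpow_add (hpos x hx), add_neg_cancel,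
      Real.rpow_zero, one_smul]
  have hflux' : ∀ x, x ≠ a → HasDerivAt (degFlux a θ φ) (-(μ * φ x)) x := fun x hx =>
    (hψ x hx).congr_of_eventuallyEq <| by
      filter_upwards [isOpen_ne.mem_nhds hx] with z hz using hflux z hz
  have hop : degOp a θ φ =ᵐ[unitMeasure] fun x => -(μ * φ x) := by
    filter_upwards [ae_ne_unitMeasure a] with x hx using (hflux' x hx).deriv
  have hac : ∀ b c, a ∉ uIcc b c → AbsolutelyContinuousOnInterval φ b c := fun b c hbc => by
    have hne : ∀ x ∈ uIcc b c, x ≠ a := fun x hx h => hbc (h ▸ hx)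
    refine absolutelyContinuousOnInterval_of_hasDerivAt (fun x hx => hφ x (hne x hx))
      fun x hx => ContinuousAt.continuousWithinAt ?_
    refine ContinuousAt.smul ?_ (hψ x (hne x hx)).continuousAt
    exact ((continuous_id.sub continuous_const).abs.continuousAt).rpow_const
      (Or.inl (hpos x (hne x hx)).ne')
  have hacflux : ∀ b c, a ∉ uIcc b c → AbsolutelyContinuousOnInterval (degFlux a θ φ) b c :=
    fun b c hbc => by
      have hne : ∀ x ∈ uIcc b c, x ≠ a := fun x hx h => hbc (h ▸ hx)
      exact absolutelyContinuousOnInterval_of_hasDerivAt (fun x hx => hflux' x (hne x hx))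
        fun x hx => ((hφ x (hne x hx)).continuousAt.const_mul μ).neg.continuousWithinAt
  refine
    { mem :=
        { memLp := hLp
          ac_left := fun b hb => hac 0 b ?_
          ac_right := fun b hb => hac b 1 ?_
          energy := ?_
          left_zero := h0
          right_zero := h1
          flux_ac_left := fun b hb c hc => hacflux b c fun h =>
            lt_irrefl a (ordConnected_Ioo.uIcc_subset hb hc h).2
          flux_ac_right := fun b hb c hc => hacflux b c fun h =>
            lt_irrefl a (ordConnected_Ioo.uIcc_subset hb hc h).1
          op_memLp := (memLp_congr_ae hop).2 (hLp.const_mul μ).neg }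
      nontrivial := hne
      eqn := ?_ }
  · rw [uIcc_of_le hb.1]
    exact fun h => not_lt.2 h.2 hb.2
  · rw [uIcc_of_le hb.2]
    exact fun h => not_lt.2 h.1 hb.1
  · have hmeas : Measurable fun x => |x - a| ^ θ * ‖deriv φ x‖ ^ 2 :=
      ((measurable_id.sub_const a).abs.pow_const θ).mul ((measurable_deriv φ).norm.pow_const 2)
    refine Integrable.of_bound hmeas.aestronglyMeasurable (C ^ 2) ?_
    filter_upwards [ae_restrict_mem measurableSet_Ioo, ae_ne_unitMeasure a] with x hx hxa
    have hd : 0 < |x - a| := hpos x hxa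
    have hd1 : |x - a| ≤ 1 := by
      rw [abs_le]; constructor <;> linarith [hx.1, hx.2, ha.1, ha.2]
    have h2 : |x - a| ^ (-θ) * |x - a| ^ 2 ≤ 1 := by
      rw [← Real.rpow_natCast, ← Real.rpow_add hd]
      exact Real.rpow_le_one hd.le hd1 (by push_cast; linarith)
    rw [Real.norm_eq_abs, abs_of_nonneg (by positivity), (hφ x hxa).deriv, norm_smul,
      Real.norm_eq_abs, abs_of_pos (Real.rpow_pos_of_pos hd _), mul_pow]
    calc |x - a| ^ θ * ((|x - a| ^ (-θ)) ^ 2 * ‖ψ x‖ ^ 2)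
        = |x - a| ^ (-θ) * ‖ψ x‖ ^ 2 := by
          have : |x - a| ^ θ * |x - a| ^ (-θ) = 1 := by
            rw [← Real.rpow_add hd, add_neg_cancel, Real.rpow_zero]
          linear_combination (|x - a| ^ (-θ) * ‖ψ x‖ ^ 2) * this
      _ ≤ |x - a| ^ (-θ) * (C * |x - a|) ^ 2 := by
          gcongr
          exact hbound x hx
      _ = C ^ 2 * (|x - a| ^ (-θ) * |x - a| ^ 2) := by ring
      _ ≤ C ^ 2 * 1 := by gcongr
      _ = C ^ 2 := mul_one _
  · filter_upwards [hop] with x hx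
    rw [hx, neg_neg]

/-- The differential equation holds classically on an interval that avoids the degenerate point. -/
lemma IsEigenpair.hasDerivAt (h : IsEigenpair a θ μ φ) {α β : ℝ} (hsub : Ioo α β ⊆ Ioo 0 1)
    (hne : ∀ x ∈ Ioo α β, x ≠ a)
    (hac : ∀ b ∈ Ioo α β, ∀ c ∈ Ioo α β, AbsolutelyContinuousOnInterval φ b c)
    (hfl : ∀ b ∈ Ioo α β, ∀ c ∈ Ioo α β, AbsolutelyContinuousOnInterval (degFlux a θ φ) b c) :
    ∀ x ∈ Ioo α β, HasDerivAt φ ((|x - a| ^ (-θ) : ℝ) • degFlux a θ φ x) x ∧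
      HasDerivAt (degFlux a θ φ) (-(μ * φ x)) x := by
  have hcont : ∀ f : ℝ → 𝕜,
      (∀ b ∈ Ioo α β, ∀ c ∈ Ioo α β, AbsolutelyContinuousOnInterval f b c) →
      ContinuousOn f (Ioo α β) := fun f hf x hx => by
    obtain ⟨b, hb⟩ := exists_between hx.1
    obtain ⟨c, hc⟩ := exists_between hx.2
    have h1 := (hf b ⟨hb.1, hb.2.trans hx.2⟩ c ⟨hx.1.trans hc.1, hc.2⟩).continuousOn
    rw [uIcc_of_le (hb.2.trans hc.1).le] at h1
    exact (h1.continuousAt (Icc_mem_nhds hb.2 hc.1)).continuousWithinAt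
  have h1 := hasDerivAt_of_absolutelyContinuousOnInterval hac
    (g := fun x => (|x - a| ^ (-θ) : ℝ) • degFlux a θ φ x) (fun x hx => by
      refine ContinuousWithinAt.smul ?_ (hcont _ hfl x hx)
      exact (((continuous_id.sub continuous_const).abs.continuousAt).rpow_const
        (Or.inl (abs_pos.2 (sub_ne_zero.2 (hne x hx))).ne')).continuousWithinAt)
    (Eventually.of_forall fun x hx => by
      rw [degFlux, smul_smul, ← Real.rpow_add (abs_pos.2 (sub_ne_zero.2 (hne x hx))),
        neg_add_cancel, Real.rpow_zero, one_smul])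
  have h2 := hasDerivAt_of_absolutelyContinuousOnInterval hfl
    (g := fun x => -(μ * φ x)) (continuousOn_const.mul (hcont _ hac)).neg (by
      have := (ae_restrict_iff' measurableSet_Ioo).1 h.eqn
      filter_upwards [this] with x hx hx'
      exact neg_eq_iff_eq_neg.1 (hx (hsub hx')))
  exact fun x hx => ⟨h1 x hx, h2 x hx⟩

lemma IsEigenpair.hasDerivAt_right (h : IsEigenpair a θ μ φ) (ha : a ∈ Ioo (0 : ℝ) 1) :
    ∀ x ∈ Ioo a 1, HasDerivAt φ ((|x - a| ^ (-θ) : ℝ) • degFlux a θ φ x) x ∧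
      HasDerivAt (degFlux a θ φ) (-(μ * φ x)) x :=
  h.hasDerivAt (Ioo_subset_Ioo_left ha.1.le) (fun _ hx => hx.1.ne')
    (fun b hb c hc => (h.mem.ac_right (min b c) ⟨lt_min hb.1 hc.1,
      (min_le_left _ _).trans hb.2.le⟩).mono <| by
        rw [uIcc_of_le ((min_le_left b c).trans hb.2.le)]
        exact fun x hx => ⟨hx.1, hx.2.trans (max_le hb.2.le hc.2.le)⟩)
    h.mem.flux_ac_right

lemma IsEigenpair.hasDerivAt_left (h : IsEigenpair a θ μ φ) (ha : a ∈ Ioo (0 : ℝ) 1) :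
    ∀ x ∈ Ioo 0 a, HasDerivAt φ ((|x - a| ^ (-θ) : ℝ) • degFlux a θ φ x) x ∧
      HasDerivAt (degFlux a θ φ) (-(μ * φ x)) x :=
  h.hasDerivAt (Ioo_subset_Ioo_right ha.2.le) (fun _ hx => hx.2.ne)
    (fun b hb c hc => (h.mem.ac_left (max b c) ⟨hb.1.le.trans (le_max_left _ _),
      max_lt hb.2 hc.2⟩).mono <| by
        rw [uIcc_of_le (hb.1.le.trans (le_max_left b c))]
        exact fun x hx => ⟨(le_min hb.1.le hc.1.le).trans hx.1, hx.2⟩)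
    h.mem.flux_ac_left

/-- Rescaling `r ↦ a + σ r`, with `σ = 1 - a` or `σ = -a`, turns an eigenfunction into a solution on
`(0,1)` that is orthogonal to every bounded solution `y_λ` with `y_λ(1) = 0` and
`λ ≠ μ |σ|^{2-θ}`. -/
lemma IsEigenpair.integral_eq_zero (h : IsEigenpair a θ μ φ) (hθ : θ ∈ Ico (1 : ℝ) 2)
    (ha : a ∈ Ioo (0 : ℝ) 1) {σ : ℝ} (hσ : σ = 1 - a ∨ σ = -a) {lam : ℝ}
    (hlam : degProfile θ lam 1 = 0) (hne : μ * ((|σ| ^ (2 - θ) : ℝ) : 𝕜) ≠ (lam : 𝕜)) :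
    ∫ r in (0 : ℝ)..1, degProfile θ lam r • φ (a + σ * r) = 0 := by
  have ha0 := ha.1
  have ha1 := ha.2
  have hσ0 : σ ≠ 0 := by
    rcases hσ with rfl | rfl <;> [exact (sub_pos.2 ha1).ne'; exact neg_ne_zero.2 ha0.ne']
  have hσI : a + σ ∈ Icc (0 : ℝ) 1 := by rcases hσ with rfl | rfl <;> simp
  have habs : 0 < |σ| := abs_pos.2 hσ0
  have hclass : ∀ r ∈ Ioo (0 : ℝ) 1,
      HasDerivAt φ ((|a + σ * r - a| ^ (-θ) : ℝ) • degFlux a θ φ (a + σ * r)) (a + σ * r) ∧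
      HasDerivAt (degFlux a θ φ) (-(μ * φ (a + σ * r))) (a + σ * r) := by
    intro r hr
    rcases hσ with rfl | rfl
    · exact h.hasDerivAt_right ha _ ⟨by nlinarith [hr.1], by nlinarith [hr.2]⟩
    · exact h.hasDerivAt_left ha _ ⟨by nlinarith [hr.2], by nlinarith [hr.1]⟩
  have haff : ∀ r : ℝ, HasDerivAt (fun r : ℝ => a + σ * r) σ r := fun r => by
    simpa using ((hasDerivAt_id r).const_mul σ).const_add a
  have hdist : ∀ r : ℝ, 0 < r → |a + σ * r - a| = |σ| * r := fun r hr => by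
    rw [add_sub_cancel_left, abs_mul, abs_of_pos hr]
  set u : ℝ → 𝕜 := fun r => φ (a + σ * r)
  set p : ℝ → 𝕜 := fun r => (σ * |σ| ^ (-θ) : ℝ) • degFlux a θ φ (a + σ * r)
  have hsol : IsDegSolution θ (μ * ((|σ| ^ (2 - θ) : ℝ) : 𝕜)) u p := by
    refine ⟨fun r hr => ?_, fun r hr => ?_⟩
    · refine ((hclass r hr).1.scomp r (haff r)).congr_deriv ?_
      simp only [p, smul_smul]
      rw [hdist r hr.1, Real.mul_rpow habs.le hr.1.le]
      congr 1
      ring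
    · refine (((hclass r hr).2.scomp r (haff r)).const_smul (σ * |σ| ^ (-θ))).congr_deriv ?_
      have e : |σ| ^ (2 - θ) = σ * |σ| ^ (-θ) * σ := by
        rw [show 2 - θ = -θ + 2 by ring, Real.rpow_add habs]
        norm_num
        ring
      rw [e]
      simp only [RCLike.real_smul_eq_coe_mul, u]
      push_cast
      ring
  have hu : IntervalIntegrable u volume 0 1 :=
    intervalIntegrable_of_memLp (memLp_comp_affine ha hσI hσ0 h.mem.memLp)
  have hE : IntegrableOn (fun r : ℝ => r ^ (-θ) * ‖p r‖ ^ 2) (Ioo 0 1) := by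
    have h1 := memLp_one_iff_integrable.1
      (memLp_comp_affine ha hσI hσ0 (memLp_one_iff_integrable.2 h.mem.energy))
    refine (h1.const_mul (|σ| ^ (2 - θ))).congr ?_
    filter_upwards [ae_restrict_mem measurableSet_Ioo] with r hr
    have hr0 := hr.1
    simp only [p, degFlux]
    rw [hdist r hr0, norm_smul, norm_smul, Real.norm_eq_abs, Real.norm_eq_abs, abs_mul,
      abs_of_pos (Real.rpow_pos_of_pos habs _),
      abs_of_pos (Real.rpow_pos_of_pos (mul_pos habs hr0) _), Real.mul_rpow habs.le hr0.le]
    have e1 : |σ| ^ (2 - θ) = |σ| ^ (-θ) * |σ| ^ 2 := by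
      rw [show 2 - θ = -θ + 2 by ring, Real.rpow_add habs]; norm_num
    have e2 : r ^ (-θ) * r ^ θ = 1 := by
      rw [← Real.rpow_add hr0, neg_add_cancel, Real.rpow_zero]
    have e3 : |σ| ^ (-θ) * |σ| ^ θ = 1 := by
      rw [← Real.rpow_add habs, neg_add_cancel, Real.rpow_zero]
    rw [e1]
    generalize |σ| ^ (-θ) = A at *
    generalize |σ| ^ θ = B at *
    generalize r ^ (-θ) = A' at *
    generalize r ^ θ = B' at *
    have : A' * (|σ| * A * (B * B' * ‖deriv φ (a + σ * r)‖)) ^ 2 =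
        (A * B) * (A' * B') * (A * |σ| ^ 2 * (B * B' * ‖deriv φ (a + σ * r)‖ ^ 2)) := by ring
    rw [this, e2, e3]
    ring
  have hend : Tendsto u (𝓝[<] 1) (𝓝 0) := by
    have haff1 : Tendsto (fun r : ℝ => a + σ * r) (𝓝[<] 1) (𝓝 (a + σ)) := by
      have := (haff 1).continuousAt.tendsto.mono_left (nhdsWithin_le_nhds (s := Iio 1))
      simpa using this
    rcases hσ with rfl | rfl
    · have hc := (h.mem.ac_right ((a + 1) / 2) ⟨by linarith, by linarith⟩).continuousOn
      rw [uIcc_of_le (by linarith)] at hc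
      have h1 := hc 1 (right_mem_Icc.2 (by linarith))
      have h2 : Tendsto φ (𝓝[Icc ((a + 1) / 2) 1] 1) (𝓝 0) := by
        have := h1.tendsto; rwa [h.mem.right_zero] at this
      refine h2.comp (tendsto_nhdsWithin_iff.2 ⟨by simpa using haff1, ?_⟩)
      filter_upwards [Ioo_mem_nhdsLT (show (1 / 2 : ℝ) < 1 by norm_num)] with r hr
      exact ⟨by nlinarith [hr.1], by nlinarith [hr.2]⟩
    · have hc := (h.mem.ac_left (a / 2) ⟨by linarith, by linarith⟩).continuousOn
      rw [uIcc_of_le (by linarith)] at hc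
      have h1 := hc 0 (left_mem_Icc.2 (by linarith))
      have h2 : Tendsto φ (𝓝[Icc 0 (a / 2)] 0) (𝓝 0) := by
        have := h1.tendsto; rwa [h.mem.left_zero] at this
      refine h2.comp (tendsto_nhdsWithin_iff.2 ⟨by simpa using haff1, ?_⟩)
      filter_upwards [Ioo_mem_nhdsLT (show (1 / 2 : ℝ) < 1 by norm_num)] with r hr
      exact ⟨by nlinarith [hr.2], by nlinarith [hr.1]⟩
  exact hsol.integral_mul_eq_zero hθ (hsol.tendsto_flux_zero hθ.1 hu hE) hu hend hlam hne

end Eigenpair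

/-! ### Normalized eigenfunctions and the orthonormal basis -/

section Eigenfunctions

variable {a θ : ℝ}

/-- The `n`-th Dirichlet eigenvalue of `-(r^θ y')'` on `(0,1)`. -/
noncomputable def unitEigval (θ : ℝ) (n : ℕ) : ℝ := degExp θ ^ 2 * besselZero (degOrder θ) n ^ 2

/-- The factor by which the `n`-th normalized eigenfunction on an interval of length `ℓ` differs
from the rescaled `degProfile`. -/
noncomputable def eigfunConst (θ l : ℝ) (n : ℕ) : ℝ :=
  √(2 * degExp θ / l) / |deriv (besselJ (degOrder θ)) (besselZero (degOrder θ) n)| *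
    (besselZero (degOrder θ) n / 2) ^ degOrder θ

lemma degProfile_unitEigval_one (hθ : θ ∈ Ico (1 : ℝ) 2) (n : ℕ) :
    degProfile θ (unitEigval θ n) 1 = 0 :=
  (degProfile_one_eq_zero_iff hθ.2 (besselZero_pos hθ n)).2 (besselJ_besselZero hθ n)

lemma exists_eq_unitEigval (hθ : θ ∈ Ico (1 : ℝ) 2) {lam : ℝ} (hlam : 0 < lam)
    (h : degProfile θ lam 1 = 0) : ∃ n, lam = unitEigval θ n := by
  obtain ⟨z, hz, rfl⟩ := exists_eq_degExp_sq_mul hθ.2 hlam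
  have hmem : z ∈ range (besselZero (degOrder θ)) := by
    rw [range_besselZero hθ]
    exact ⟨hz, (degProfile_one_eq_zero_iff hθ.2 hz).1 h⟩
  obtain ⟨n, rfl⟩ := hmem
  exact ⟨n, rfl⟩

lemma injective_unitEigval (hθ : θ ∈ Ico (1 : ℝ) 2) : Function.Injective (unitEigval θ) := by
  intro n m hnm
  have h1 := (pow_pos (degExp_pos hθ.2) 2).ne'
  have h2 := mul_left_cancel₀ h1 hnm
  exact (strictMono_besselZero hθ).injective
    ((pow_left_inj₀ (besselZero_pos hθ n).le (besselZero_pos hθ m).le two_ne_zero).1 h2)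

/-- The identity `s^{(1-θ)/2} J_ν(z s^k) = (z / 2)^ν y(s)`: the power of `s` cancels since
`k ν = (θ - 1) / 2`. -/
lemma rpow_mul_besselJ (hθ : θ ∈ Ico (1 : ℝ) 2) {z s : ℝ} (hz : 0 < z) (hs : 0 < s) :
    s ^ ((1 - θ) / 2) * besselJ (degOrder θ) (z * s ^ degExp θ) =
      (z / 2) ^ degOrder θ * degProfile θ (degExp θ ^ 2 * z ^ 2) s := by
  have hsk : 0 < s ^ degExp θ := Real.rpow_pos_of_pos hs _
  rw [besselJ_eq (mul_pos hz hsk), degProfile_degExp_sq_mul hθ.2,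
    show z * s ^ degExp θ / 2 = z / 2 * s ^ degExp θ by ring,
    Real.mul_rpow (by positivity) hsk.le, ← Real.rpow_mul hs.le, mul_pow, ← Real.rpow_natCast,
    ← Real.rpow_natCast, ← Real.rpow_mul hs.le]
  have e1 : degExp θ * degOrder θ = -((1 - θ) / 2) := by
    have := degOrder_add_one_mul hθ
    rw [degExp]
    linarith
  have e2 : degExp θ * ((2 : ℕ) : ℝ) = 2 - θ := by rw [degExp]; push_cast; ring
  rw [e1, e2, Real.rpow_natCast]
  have e3 : s ^ ((1 - θ) / 2) * s ^ (-((1 - θ) / 2)) = 1 := by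
    rw [← Real.rpow_add hs, add_neg_cancel, Real.rpow_zero]
  linear_combination ((z / 2) ^ degOrder θ *
    besselEntire (degOrder θ) (z ^ 2 * s ^ (2 - θ) / 4)) * e3

lemma eigfunRight_affine (hθ : θ ∈ Ico (1 : ℝ) 2) (ha : a < 1) (n : ℕ) {r : ℝ} (hr : 0 < r) :
    eigfunRight a θ n (a + (1 - a) * r) =
      eigfunConst θ (1 - a) n * degProfile θ (unitEigval θ n) r := by
  have ha' : 0 < 1 - a := by linarith
  rw [eigfunRight, if_neg (by nlinarith), add_sub_cancel_left, mul_div_cancel_left₀ _ ha'.ne',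
    mul_assoc, rpow_mul_besselJ hθ (besselZero_pos hθ n) hr, eigfunConst, unitEigval]
  ring

lemma eigfunLeft_affine (hθ : θ ∈ Ico (1 : ℝ) 2) (ha : 0 < a) (n : ℕ) {r : ℝ} (hr : 0 < r) :
    eigfunLeft a θ n (a + -a * r) =
      eigfunConst θ a n * degProfile θ (unitEigval θ n) r := by
  have e : |(a + -a * r - a) / a| = r := by
    rw [add_sub_cancel_left, neg_mul, neg_div, mul_div_cancel_left₀ _ ha.ne', abs_neg,
      abs_of_pos hr]
  rw [eigfunLeft, if_pos (by nlinarith), e,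
    mul_assoc, rpow_mul_besselJ hθ (besselZero_pos hθ n) hr, eigfunConst, unitEigval]
  ring

lemma eigfunRight_of_lt (n : ℕ) {x : ℝ} (hx : x < a) : eigfunRight a θ n x = 0 := if_pos hx

lemma eigfunLeft_of_le (n : ℕ) {x : ℝ} (hx : a ≤ x) : eigfunLeft a θ n x = 0 :=
  if_neg (not_lt.2 hx)

lemma degProfile_div {l r : ℝ} (hl : 0 < l) (hr : 0 ≤ r) (lam : ℝ) :
    degProfile θ lam (r / l) = degProfile θ (lam / l ^ (2 - θ)) r := by
  rw [degProfile, degProfile, Real.div_rpow hr hl.le]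
  congr 1
  ring

lemma eigvalRight_eq (n : ℕ) : eigvalRight a θ n = unitEigval θ n / (1 - a) ^ (2 - θ) := by
  rw [eigvalRight, unitEigval, degExp, mul_div_cancel₀ _ two_ne_zero]

lemma eigvalLeft_eq (n : ℕ) : eigvalLeft a θ n = unitEigval θ n / a ^ (2 - θ) := by
  rw [eigvalLeft, unitEigval, degExp, mul_div_cancel₀ _ two_ne_zero]

lemma eigfunRight_eq (hθ : θ ∈ Ico (1 : ℝ) 2) (ha : a < 1) (n : ℕ) {x : ℝ} (hx : x ≠ a) :
    eigfunRight a θ n x = (if x < a then 0 else eigfunConst θ (1 - a) n) *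
      degProfile θ (eigvalRight a θ n) |x - a| := by
  have ha' : 0 < 1 - a := by linarith
  rcases lt_or_gt_of_ne hx with h | h
  · rw [eigfunRight_of_lt n h, if_pos h, zero_mul]
  · have hr : 0 < x - a := sub_pos.2 h
    have e : x = a + (1 - a) * ((x - a) / (1 - a)) := by field_simp; ring
    rw [if_neg (not_lt.2 h.le), abs_of_pos hr, eigvalRight_eq, ← degProfile_div ha' hr.le,
      ← eigfunRight_affine hθ ha n (div_pos hr ha'), ← e]

lemma eigfunLeft_eq (hθ : θ ∈ Ico (1 : ℝ) 2) (ha : 0 < a) (n : ℕ) {x : ℝ} (hx : x ≠ a) :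
    eigfunLeft a θ n x = (if x < a then eigfunConst θ a n else 0) *
      degProfile θ (eigvalLeft a θ n) |x - a| := by
  rcases lt_or_gt_of_ne hx with h | h
  · have hr : 0 < a - x := sub_pos.2 h
    have e : x = a + -a * ((a - x) / a) := by field_simp; ring
    rw [if_pos h, abs_sub_comm, abs_of_pos hr, eigvalLeft_eq, ← degProfile_div ha hr.le,
      ← eigfunLeft_affine hθ ha n (div_pos hr ha), ← e]
  · rw [eigfunLeft_of_le n h.le, if_neg (not_lt.2 h.le), zero_mul]

/-- `2k (z/2)^{2ν} ∫_0^1 y² = J_ν'(z)²` at a zero `z` of `J_ν`, the classical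
`∫_0^1 x J_ν(z x)² dx = J_ν'(z)² / 2`. -/
lemma eigfunConst_sq_mul_integral (hθ : θ ∈ Ico (1 : ℝ) 2) (n : ℕ) {l : ℝ} (hl : 0 < l) :
    l * eigfunConst θ l n * (eigfunConst θ l n *
      ∫ r in (0 : ℝ)..1,
        degProfile θ (unitEigval θ n) r * degProfile θ (unitEigval θ n) r) = 1 := by
  set z := besselZero (degOrder θ) n
  have hz : 0 < z := besselZero_pos hθ n
  have hk := degExp_pos hθ.2
  have hJ := besselJ_besselZero hθ n
  have hB := besselEntire_succ_ne_zero hθ hz hJ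
  have hd := (hasDerivAt_besselJ_of_eq_zero (degOrder_nonneg hθ.2) hz hJ).deriv
  have hP := integral_degProfile_sq hθ (degProfile_unitEigval_one hθ n)
  rw [unitEigval, degProfileFlux_degExp_sq_mul hθ.2, Real.one_rpow, mul_one, mul_one,
    show 2 - θ = 2 * degExp θ by rw [degExp]; ring] at hP
  simp only [← sq]
  rw [unitEigval, eigfunConst, hd]
  have hI : ∫ r in (0 : ℝ)..1, degProfile θ (degExp θ ^ 2 * z ^ 2) r ^ 2 =
      z ^ 2 * besselEntire (degOrder θ + 1) (z ^ 2 / 4) ^ 2 / (8 * degExp θ) := by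
    rw [eq_div_iff (by positivity)]
    have h0 : degExp θ ^ 2 * z ^ 2 ≠ 0 := by positivity
    refine mul_left_cancel₀ h0 ?_
    linear_combination 4 * hP
  rw [hI, abs_neg, abs_mul, abs_mul, abs_of_pos (Real.rpow_pos_of_pos (half_pos hz) _),
    abs_of_pos (half_pos hz)]
  have hs : √(2 * degExp θ / l) ^ 2 = 2 * degExp θ / l := Real.sq_sqrt (by positivity)
  have hw := Real.rpow_pos_of_pos (half_pos hz) (degOrder θ)
  generalize √(2 * degExp θ / l) = s at *
  change l * (s / ((z / 2) ^ degOrder θ * (z / 2) * _) * (z / 2) ^ degOrder θ) *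
    (s / ((z / 2) ^ degOrder θ * (z / 2) * _) * (z / 2) ^ degOrder θ * _) = 1
  generalize (z / 2) ^ degOrder θ = w at *
  generalize besselEntire (degOrder θ + 1) (z ^ 2 / 4) = B at *
  rw [← sq_abs B]
  have hB' : 0 < |B| := abs_pos.2 hB
  generalize |B| = B' at *
  have : l * (s / (w * (z / 2) * B') * w) * (s / (w * (z / 2) * B') * w *
      (z ^ 2 * B' ^ 2 / (8 * degExp θ))) = l * s ^ 2 / (2 * degExp θ) := by
    field_simp
    norm_num
  rw [this, hs]
  field_simp

end Eigenfunctions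

section Integrals

variable {𝕜 : Type*} [RCLike 𝕜] {a θ : ℝ}

lemma setIntegral_right_eq (ha : a < 1) (f : ℝ → 𝕜) :
    ∫ x in Ioo a 1, f x = (1 - a) • ∫ r in (0 : ℝ)..1, f (a + (1 - a) * r) := by
  rw [intervalIntegral.smul_integral_comp_add_mul, mul_zero, add_zero, mul_one,
    add_sub_cancel, intervalIntegral.integral_of_le ha.le, integral_Ioc_eq_integral_Ioo]

lemma setIntegral_left_eq (ha : 0 < a) (f : ℝ → 𝕜) :
    ∫ x in Ioo 0 a, f x = a • ∫ r in (0 : ℝ)..1, f (a + -a * r) := by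
  have h := intervalIntegral.smul_integral_comp_add_mul (a := 0) (b := 1) f (-a) a
  rw [mul_zero, add_zero, mul_one, add_neg_cancel, intervalIntegral.integral_symm 0 a, neg_smul,
    neg_inj, intervalIntegral.integral_of_le ha.le, integral_Ioc_eq_integral_Ioo] at h
  exact h.symm

lemma intervalIntegral_zero_one_congr {f g : ℝ → 𝕜} (h : ∀ r ∈ Ioo (0 : ℝ) 1, f r = g r) :
    ∫ r in (0 : ℝ)..1, f r = ∫ r in (0 : ℝ)..1, g r := by
  rw [intervalIntegral.integral_of_le zero_le_one, intervalIntegral.integral_of_le zero_le_one,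
    integral_Ioc_eq_integral_Ioo, integral_Ioc_eq_integral_Ioo]
  exact setIntegral_congr_fun measurableSet_Ioo h

lemma integral_eigfunRight_smul (hθ : θ ∈ Ico (1 : ℝ) 2) (ha : a ∈ Ioo (0 : ℝ) 1) (n : ℕ)
    (f : ℝ → 𝕜) :
    ∫ x, eigfunRight a θ n x • f x ∂unitMeasure = ((1 - a) * eigfunConst θ (1 - a) n) •
      ∫ r in (0 : ℝ)..1, degProfile θ (unitEigval θ n) r • f (a + (1 - a) * r) := by
  rw [setIntegral_eq_of_subset_of_ae_sdiff_eq_zero (s := Ioo a 1)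
    measurableSet_Ioo.nullMeasurableSet (Ioo_subset_Ioo_left ha.1.le) ?_,
    setIntegral_right_eq ha.2, mul_smul,
    ← intervalIntegral.integral_smul (eigfunConst θ (1 - a) n)]
  · refine congrArg _ (intervalIntegral_zero_one_congr (𝕜 := 𝕜) fun r hr => ?_)
    rw [eigfunRight_affine hθ ha.2 n hr.1, mul_smul]
  · filter_upwards [Measure.ae_ne volume a] with x hxa hx
    have hlt : x < a := by
      by_contra! hge
      exact hx.2 ⟨lt_of_le_of_ne hge hxa.symm, hx.1.2⟩
    rw [eigfunRight_of_lt n hlt, zero_smul]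

lemma integral_eigfunLeft_smul (hθ : θ ∈ Ico (1 : ℝ) 2) (ha : a ∈ Ioo (0 : ℝ) 1) (n : ℕ)
    (f : ℝ → 𝕜) :
    ∫ x, eigfunLeft a θ n x • f x ∂unitMeasure = (a * eigfunConst θ a n) •
      ∫ r in (0 : ℝ)..1, degProfile θ (unitEigval θ n) r • f (a + -a * r) := by
  rw [setIntegral_eq_of_subset_of_ae_sdiff_eq_zero (s := Ioo 0 a)
    measurableSet_Ioo.nullMeasurableSet (Ioo_subset_Ioo_right ha.2.le) ?_,
    setIntegral_left_eq ha.1, mul_smul, ← intervalIntegral.integral_smul (eigfunConst θ a n)]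
  · refine congrArg _ (intervalIntegral_zero_one_congr (𝕜 := 𝕜) fun r hr => ?_)
    rw [eigfunLeft_affine hθ ha.1 n hr.1, mul_smul]
  · refine Eventually.of_forall fun x hx => ?_
    have hle : a ≤ x := by
      by_contra! hlt
      exact hx.2 ⟨hx.1.1, hlt⟩
    rw [eigfunLeft_of_le n hle, zero_smul]

lemma integral_degProfile_unitEigval_mul (hθ : θ ∈ Ico (1 : ℝ) 2) {n m : ℕ} (hnm : n ≠ m) :
    ∫ r in (0 : ℝ)..1, degProfile θ (unitEigval θ n) r * degProfile θ (unitEigval θ m) r = 0 := by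
  have hy := continuous_degProfile hθ.2 (unitEigval θ m)
  have hq := continuous_degProfileFlux hθ.2 (unitEigval θ m)
  refine (isDegSolution_degProfile hθ (unitEigval θ m)).integral_mul_eq_zero hθ ?_
    (hy.intervalIntegrable _ _) ?_ (degProfile_unitEigval_one hθ n)
    fun h => hnm (injective_unitEigval hθ h.symm)
  · have := (hq.tendsto 0).mono_left (nhdsWithin_le_nhds (s := Ioi 0))
    rwa [degProfileFlux_zero] at this
  · have := (hy.tendsto 1).mono_left (nhdsWithin_le_nhds (s := Iio 1))
    rwa [degProfile_unitEigval_one hθ m] at this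

lemma integral_eigfunRight_mul (hθ : θ ∈ Ico (1 : ℝ) 2) (ha : a ∈ Ioo (0 : ℝ) 1) (n m : ℕ) :
    ∫ x, eigfunRight a θ n x * eigfunRight a θ m x ∂unitMeasure = if n = m then 1 else 0 := by
  refine (integral_eigfunRight_smul hθ ha n (eigfunRight a θ m)).trans ?_
  rw [intervalIntegral_zero_one_congr (g := fun r => eigfunConst θ (1 - a) m *
    (degProfile θ (unitEigval θ n) r * degProfile θ (unitEigval θ m) r)) fun r hr => by
      rw [eigfunRight_affine hθ ha.2 m hr.1, smul_eq_mul]; ring,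
    intervalIntegral.integral_const_mul, smul_eq_mul]
  split_ifs with h
  · subst h
    exact eigfunConst_sq_mul_integral hθ n (sub_pos.2 ha.2)
  · rw [integral_degProfile_unitEigval_mul hθ h, mul_zero, mul_zero]

lemma integral_eigfunLeft_mul (hθ : θ ∈ Ico (1 : ℝ) 2) (ha : a ∈ Ioo (0 : ℝ) 1) (n m : ℕ) :
    ∫ x, eigfunLeft a θ n x * eigfunLeft a θ m x ∂unitMeasure = if n = m then 1 else 0 := by
  refine (integral_eigfunLeft_smul hθ ha n (eigfunLeft a θ m)).trans ?_
  rw [intervalIntegral_zero_one_congr (g := fun r => eigfunConst θ a m *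
    (degProfile θ (unitEigval θ n) r * degProfile θ (unitEigval θ m) r)) fun r hr => by
      rw [eigfunLeft_affine hθ ha.1 m hr.1, smul_eq_mul]; ring,
    intervalIntegral.integral_const_mul, smul_eq_mul]
  split_ifs with h
  · subst h
    exact eigfunConst_sq_mul_integral hθ n ha.1
  · rw [integral_degProfile_unitEigval_mul hθ h, mul_zero, mul_zero]

lemma eigfunRight_mul_eigfunLeft (n m : ℕ) (x : ℝ) :
    eigfunRight a θ n x * eigfunLeft a θ m x = 0 := by
  rcases lt_or_ge x a with h | h
  · rw [eigfunRight_of_lt n h, zero_mul]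
  · rw [eigfunLeft_of_le m h, mul_zero]

lemma ae_eq_zero_of_forall_integral_unitEigval (hθ : θ ∈ Ico (1 : ℝ) 2) {g : ℝ → 𝕜}
    (hg : MemLp g 2 unitMeasure)
    (h : ∀ n, ∫ r in (0 : ℝ)..1, degProfile θ (unitEigval θ n) r • g r = 0) :
    g =ᵐ[unitMeasure] 0 := by
  have hint : ∀ n, IntervalIntegrable (fun r => degProfile θ (unitEigval θ n) r • g r) volume 0 1 :=
    fun n => (intervalIntegrable_of_memLp hg).continuousOn_smul
      (continuous_degProfile hθ.2 _).continuousOn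
  have key : ∀ L : 𝕜 →L[ℝ] ℝ, MemLp (fun r => L (g r)) 2 unitMeasure →
      (fun r => L (g r)) =ᵐ[unitMeasure] 0 := fun L hL => by
    refine ae_eq_zero_of_forall_integral_degProfile_eq_zero hθ hL fun lam hlam hy => ?_
    obtain ⟨n, rfl⟩ := exists_eq_unitEigval hθ hlam hy
    have h1 := L.intervalIntegral_comp_comm (hint n)
    rw [h n, map_zero] at h1
    simpa only [map_smul, smul_eq_mul] using h1
  filter_upwards [key RCLike.reCLM hg.re, key RCLike.imCLM hg.im] with r h1 h2
  exact RCLike.ext (by simpa using h1) (by simpa using h2)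

lemma ae_eq_zero_of_ae_eq_zero_affine (ha : a ∈ Ioo (0 : ℝ) 1) {f : ℝ → 𝕜}
    (h1 : (fun r => f (a + (1 - a) * r)) =ᵐ[unitMeasure] 0)
    (h2 : (fun r => f (a + -a * r)) =ᵐ[unitMeasure] 0) : f =ᵐ[unitMeasure] 0 := by
  have ha0 := ha.1
  have ha1 : 0 < 1 - a := sub_pos.2 ha.2
  have e1 : ∀ᵐ x : ℝ, x ∈ Ioo a 1 → f x = 0 := by
    rw [← ae_affine_iff a ha1.ne']
    filter_upwards [(ae_restrict_iff' measurableSet_Ioo).1 h1] with r hr hr'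
    refine hr ⟨?_, ?_⟩ <;> by_contra! hcon <;> nlinarith [hr'.1, hr'.2]
  have e2 : ∀ᵐ x : ℝ, x ∈ Ioo 0 a → f x = 0 := by
    rw [← ae_affine_iff a (neg_ne_zero.2 ha0.ne')]
    filter_upwards [(ae_restrict_iff' measurableSet_Ioo).1 h2] with r hr hr'
    refine hr ⟨?_, ?_⟩ <;> by_contra! hcon <;> nlinarith [hr'.1, hr'.2]
  rw [EventuallyEq, ae_restrict_iff' measurableSet_Ioo]
  filter_upwards [e1, e2, Measure.ae_ne volume a] with x hx1 hx2 hxa hx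
  rcases lt_or_gt_of_ne hxa with h | h
  · exact hx2 ⟨hx.1, h⟩
  · exact hx1 ⟨h, hx.2⟩

/-- The eigenfunctions of both sides together separate `L²(0,1)`. -/
lemma ae_eq_zero_of_forall_integral_eigfun (hθ : θ ∈ Ico (1 : ℝ) 2) (ha : a ∈ Ioo (0 : ℝ) 1)
    {f : ℝ → 𝕜} (hf : MemLp f 2 unitMeasure)
    (h1 : ∀ n, ∫ r in (0 : ℝ)..1, degProfile θ (unitEigval θ n) r • f (a + (1 - a) * r) = 0)
    (h2 : ∀ n, ∫ r in (0 : ℝ)..1, degProfile θ (unitEigval θ n) r • f (a + -a * r) = 0) :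
    f =ᵐ[unitMeasure] 0 :=
  ae_eq_zero_of_ae_eq_zero_affine ha
    (ae_eq_zero_of_forall_integral_unitEigval hθ
      (memLp_comp_affine ha (by simp) (sub_pos.2 ha.2).ne' hf) h1)
    (ae_eq_zero_of_forall_integral_unitEigval hθ
      (memLp_comp_affine ha (by simp) (neg_ne_zero.2 ha.1.ne') hf) h2)

end Integrals

section Main

variable {𝕜 : Type*} [RCLike 𝕜] {a θ lam c₁ c₂ : ℝ} {φ : ℝ → ℝ}

lemma hasDerivAt_ofReal_comp {f : ℝ → ℝ} {f' x : ℝ} (h : HasDerivAt f f' x) :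
    HasDerivAt (fun x => (f x : 𝕜)) (f' : 𝕜) x :=
  (RCLike.ofRealCLM (K := 𝕜)).hasFDerivAt.comp_hasDerivAt x h

lemma memLp_of_eq_degProfile (hθ : θ < 2)
    (hφ : ∀ x, x ≠ a → φ x = (if x < a then c₁ else c₂) * degProfile θ lam |x - a|) :
    MemLp (fun x => (φ x : 𝕜)) 2 unitMeasure := by
  have hy : Continuous fun x => degProfile θ lam |x - a| :=
    (continuous_degProfile hθ lam).comp (continuous_id.sub continuous_const).abs
  have h1 : MemLp (fun x => ((if x < a then c₁ else c₂) * degProfile θ lam |x - a|)) 2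
      unitMeasure := by
    refine (memLp_unitMeasure_of_continuous hy).of_le_mul (c := max |c₁| |c₂|) ?_ ?_
    · exact ((Measurable.ite measurableSet_Iio measurable_const measurable_const).mul
        hy.measurable).aestronglyMeasurable
    · refine Eventually.of_forall fun x => ?_
      rw [norm_mul]
      gcongr
      split_ifs
      · exact le_max_left _ _
      · exact le_max_right _ _
  refine MemLp.ae_eq ?_ h1.ofReal
  filter_upwards [ae_ne_unitMeasure a] with x hx
  rw [hφ x hx]

lemma isEigenpair_of_eq_degProfile (hθ : θ ∈ Ico (1 : ℝ) 2) (ha : a ∈ Ioo (0 : ℝ) 1)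
    (hφ : ∀ x, x ≠ a → φ x = (if x < a then c₁ else c₂) * degProfile θ lam |x - a|)
    (h0 : φ 0 = 0) (h1 : φ 1 = 0) (hne : ∫ x, φ x * φ x ∂unitMeasure = 1) :
    IsEigenpair a θ (lam : 𝕜) (fun x => (φ x : 𝕜)) := by
  set q : ℝ → ℝ := fun x => (if x < a then -c₁ else c₂) * degProfileFlux θ lam |x - a|
  have hder : ∀ x, x ≠ a → HasDerivAt φ (|x - a| ^ (-θ) * q x) x ∧
      HasDerivAt q (-(lam * φ x)) x := by
    intro x hx
    rcases lt_or_gt_of_ne hx with h | h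
    · have hd : 0 < a - x := sub_pos.2 h
      have haff : HasDerivAt (fun x => a - x) (-1) x := by
        simpa using (hasDerivAt_id x).const_sub a
      have e1 : φ =ᶠ[𝓝 x] fun x => c₁ * degProfile θ lam (a - x) := by
        filter_upwards [Iio_mem_nhds h] with z hz
        have hz : z < a := hz
        rw [hφ z hz.ne, if_pos hz, abs_sub_comm, abs_of_pos (sub_pos.2 hz)]
      have e2 : q =ᶠ[𝓝 x] fun x => -c₁ * degProfileFlux θ lam (a - x) := by
        filter_upwards [Iio_mem_nhds h] with z hz
        have hz : z < a := hz
        simp only [q]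
        rw [if_pos hz, abs_sub_comm, abs_of_pos (sub_pos.2 hz)]
      have d1 := (((hasDerivAt_degProfile hθ.2 lam hd).comp x haff).const_mul c₁)
        |>.congr_of_eventuallyEq e1
      have d2 := (((hasDerivAt_degProfileFlux hθ lam hd).comp x haff).const_mul
        (-c₁)).congr_of_eventuallyEq e2
      refine ⟨d1.congr_deriv ?_, d2.congr_deriv ?_⟩
      · rw [e2.eq_of_nhds, abs_sub_comm, abs_of_pos hd]; ring
      · rw [e1.eq_of_nhds]; ring
    · have hd : 0 < x - a := sub_pos.2 h
      have haff : HasDerivAt (fun x => x - a) 1 x := (hasDerivAt_id x).sub_const a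
      have e1 : φ =ᶠ[𝓝 x] fun x => c₂ * degProfile θ lam (x - a) := by
        filter_upwards [Ioi_mem_nhds h] with z hz
        have hz : a < z := hz
        rw [hφ z hz.ne', if_neg (not_lt.2 hz.le), abs_of_pos (sub_pos.2 hz)]
      have e2 : q =ᶠ[𝓝 x] fun x => c₂ * degProfileFlux θ lam (x - a) := by
        filter_upwards [Ioi_mem_nhds h] with z hz
        have hz : a < z := hz
        simp only [q]
        rw [if_neg (not_lt.2 hz.le), abs_of_pos (sub_pos.2 hz)]
      have d1 := (((hasDerivAt_degProfile hθ.2 lam hd).comp x haff).const_mul c₂)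
        |>.congr_of_eventuallyEq e1
      have d2 := (((hasDerivAt_degProfileFlux hθ lam hd).comp x haff).const_mul
        c₂).congr_of_eventuallyEq e2
      refine ⟨d1.congr_deriv ?_, d2.congr_deriv ?_⟩
      · rw [e2.eq_of_nhds, abs_of_pos hd]; ring
      · rw [e1.eq_of_nhds]; ring
  set B : ℝ → ℝ := fun r => -(lam / (2 - θ)) *
    besselEntire (degOrder θ + 1) (lam * r ^ (2 - θ) / (2 - θ) ^ 2)
  have hB : Continuous B := continuous_const.mul ((continuous_besselEntire
    (by linarith [degOrder_nonneg hθ.2])).comp (continuous_degProfile_arg hθ.2 lam))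
  obtain ⟨M, hM⟩ := (isCompact_Icc (a := (0 : ℝ)) (b := 1)).exists_bound_of_continuousOn
    hB.continuousOn
  refine isEigenpair_of_hasDerivAt (ψ := fun x => (q x : 𝕜)) (C := max |c₁| |c₂| * M) hθ.2
    (fun x hx => ?_) (fun x hx => ?_) (fun x hx => ?_) (memLp_of_eq_degProfile hθ.2 hφ)
    (by rw [h0, RCLike.ofReal_zero]) (by rw [h1, RCLike.ofReal_zero]) ?_ ha
  · have := hasDerivAt_ofReal_comp (𝕜 := 𝕜) (hder x hx).1
    rwa [RCLike.ofReal_mul, ← RCLike.real_smul_eq_coe_mul] at this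
  · have := hasDerivAt_ofReal_comp (𝕜 := 𝕜) (hder x hx).2
    rwa [RCLike.ofReal_neg, RCLike.ofReal_mul] at this
  · have hd1 : |x - a| ≤ 1 := by
      rw [abs_le]; constructor <;> linarith [hx.1, hx.2, ha.1, ha.2]
    have e : q x = (if x < a then -c₁ else c₂) * B |x - a| * |x - a| := by
      simp only [q, degProfileFlux, B]; ring
    rw [RCLike.norm_ofReal, e, abs_mul, abs_mul, abs_abs]
    gcongr
    · split_ifs
      · rw [abs_neg]; exact le_max_left _ _
      · exact le_max_right _ _
    · exact hM _ ⟨abs_nonneg _, hd1⟩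
  · intro hzero
    have h2 : ∫ x, φ x * φ x ∂unitMeasure = 0 := by
      refine integral_eq_zero_of_ae ?_
      filter_upwards [hzero] with x hx
      have : φ x = 0 := by
        have hx' : (φ x : 𝕜) = 0 := hx
        exact RCLike.ofReal_eq_zero.1 hx'
      simp [this]
    rw [h2] at hne
    exact zero_ne_one hne

lemma isEigenpair_eigfunRight (hθ : θ ∈ Ico (1 : ℝ) 2) (ha : a ∈ Ioo (0 : ℝ) 1) (n : ℕ) :
    IsEigenpair a θ ((eigvalRight a θ n : ℝ) : 𝕜) (fun x => ((eigfunRight a θ n x : ℝ) : 𝕜)) := by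
  refine isEigenpair_of_eq_degProfile hθ ha (fun x hx => eigfunRight_eq hθ ha.2 n hx)
    (eigfunRight_of_lt n ha.1) ?_ ?_
  · have := eigfunRight_affine hθ ha.2 n one_pos
    rwa [degProfile_unitEigval_one hθ, mul_zero, mul_one, add_sub_cancel] at this
  · rw [integral_eigfunRight_mul hθ ha, if_pos rfl]

lemma isEigenpair_eigfunLeft (hθ : θ ∈ Ico (1 : ℝ) 2) (ha : a ∈ Ioo (0 : ℝ) 1) (n : ℕ) :
    IsEigenpair a θ ((eigvalLeft a θ n : ℝ) : 𝕜) (fun x => ((eigfunLeft a θ n x : ℝ) : 𝕜)) := by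
  refine isEigenpair_of_eq_degProfile hθ ha (fun x hx => eigfunLeft_eq hθ ha.1 n hx)
    ?_ (eigfunLeft_of_le n ha.2.le) ?_
  · have := eigfunLeft_affine hθ ha.1 n one_pos
    rwa [degProfile_unitEigval_one hθ, mul_zero, mul_one, add_neg_cancel] at this
  · rw [integral_eigfunLeft_mul hθ ha, if_pos rfl]

/-- There are no further eigenvalues: an eigenfunction for another `μ` would be orthogonal to the
complete system of the known eigenfunctions. -/
lemma IsEigenpair.mem_range {μ : 𝕜} {φ : ℝ → 𝕜} (h : IsEigenpair a θ μ φ)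
    (hθ : θ ∈ Ico (1 : ℝ) 2) (ha : a ∈ Ioo (0 : ℝ) 1) :
    μ ∈ range (fun n : ℕ => ((eigvalRight a θ n : ℝ) : 𝕜)) ∪
      range (fun n : ℕ => ((eigvalLeft a θ n : ℝ) : 𝕜)) := by
  by_contra hμ
  rw [mem_union, not_or] at hμ
  have hscale : ∀ {l : ℝ} {n : ℕ}, 0 < l → μ * ((l ^ (2 - θ) : ℝ) : 𝕜) = (unitEigval θ n : 𝕜) →
      μ = ((unitEigval θ n / l ^ (2 - θ) : ℝ) : 𝕜) := fun {l n} hl hl' => by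
    have : ((l ^ (2 - θ) : ℝ) : 𝕜) ≠ 0 :=
      RCLike.ofReal_ne_zero.2 (Real.rpow_pos_of_pos hl _).ne'
    rw [RCLike.ofReal_div, eq_div_iff this, hl']
  refine h.nontrivial (ae_eq_zero_of_forall_integral_eigfun hθ ha h.mem.memLp
    (fun n => h.integral_eq_zero hθ ha (Or.inl rfl) (degProfile_unitEigval_one hθ n) fun he => ?_)
    (fun n => h.integral_eq_zero hθ ha (Or.inr rfl) (degProfile_unitEigval_one hθ n) fun he => ?_))
  · rw [abs_of_pos (sub_pos.2 ha.2)] at he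
    exact hμ.1 ⟨n, by simp only [eigvalRight_eq, ← hscale (sub_pos.2 ha.2) he]⟩
  · rw [abs_neg, abs_of_pos ha.1] at he
    exact hμ.2 ⟨n, by simp only [eigvalLeft_eq, ← hscale ha.1 he]⟩

lemma memLp_eigfun (hθ : θ ∈ Ico (1 : ℝ) 2) (ha : a ∈ Ioo (0 : ℝ) 1) (i : ℕ ⊕ ℕ) :
    MemLp (fun x => ((Sum.elim (eigfunRight a θ) (eigfunLeft a θ) i x : ℝ) : 𝕜)) 2 unitMeasure := by
  cases i with
  | inl n => exact memLp_of_eq_degProfile hθ.2 fun x hx => eigfunRight_eq hθ ha.2 n hx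
  | inr n => exact memLp_of_eq_degProfile hθ.2 fun x hx => eigfunLeft_eq hθ ha.1 n hx

lemma integral_eigfun_mul (hθ : θ ∈ Ico (1 : ℝ) 2) (ha : a ∈ Ioo (0 : ℝ) 1) (i j : ℕ ⊕ ℕ) :
    ∫ x, Sum.elim (eigfunRight a θ) (eigfunLeft a θ) i x *
      Sum.elim (eigfunRight a θ) (eigfunLeft a θ) j x ∂unitMeasure = if i = j then 1 else 0 := by
  cases i with
  | inl n =>
    cases j with
    | inl m => simpa using integral_eigfunRight_mul hθ ha n m
    | inr m => simp [eigfunRight_mul_eigfunLeft]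
  | inr n =>
    cases j with
    | inl m => simp [mul_comm (eigfunLeft a θ n _), eigfunRight_mul_eigfunLeft]
    | inr m => simpa using integral_eigfunLeft_mul hθ ha n m

lemma exists_hilbertBasis_eigfun (hθ : θ ∈ Ico (1 : ℝ) 2) (ha : a ∈ Ioo (0 : ℝ) 1) :
    ∃ b : HilbertBasis (ℕ ⊕ ℕ) 𝕜 (Lp 𝕜 2 unitMeasure), ∀ i, (b i : ℝ → 𝕜) =ᵐ[unitMeasure]
      fun x => ((Sum.elim (eigfunRight a θ) (eigfunLeft a θ) i x : ℝ) : 𝕜) := by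
  set e : ℕ ⊕ ℕ → ℝ → ℝ := Sum.elim (eigfunRight a θ) (eigfunLeft a θ)
  set v : ℕ ⊕ ℕ → Lp 𝕜 2 unitMeasure := fun i => (memLp_eigfun hθ ha i).toLp
  have hv : ∀ i, (v i : ℝ → 𝕜) =ᵐ[unitMeasure] fun x => ((e i x : ℝ) : 𝕜) := fun i =>
    (memLp_eigfun hθ ha i).coeFn_toLp
  have hinner : ∀ i (f : Lp 𝕜 2 unitMeasure),
      inner 𝕜 (v i) f = ∫ x, e i x • f x ∂unitMeasure := fun i f => by
    rw [L2.inner_def]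
    refine integral_congr_ae ?_
    filter_upwards [hv i] with x hx
    rw [hx, RCLike.inner_apply, RCLike.conj_ofReal, RCLike.real_smul_eq_coe_mul, mul_comm]
  have horth : Orthonormal 𝕜 v := by
    rw [orthonormal_iff_ite]
    intro i j
    have h1 : inner 𝕜 (v i) (v j) = ∫ x, ((e i x * e j x : ℝ) : 𝕜) ∂unitMeasure := by
      rw [hinner]
      refine integral_congr_ae ?_
      filter_upwards [hv j] with x hx
      rw [hx, RCLike.real_smul_eq_coe_mul, RCLike.ofReal_mul]
    rw [h1, integral_ofReal, integral_eigfun_mul hθ ha]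
    split_ifs <;> simp
  have hbot : (Submodule.span 𝕜 (range v))ᗮ = ⊥ := by
    rw [Submodule.eq_bot_iff]
    intro f hf
    have hf0 : ∀ i, ∫ x, e i x • f x ∂unitMeasure = 0 := fun i => by
      rw [← hinner]
      exact (Submodule.mem_orthogonal _ _).1 hf _ (Submodule.subset_span ⟨i, rfl⟩)
    have hc : ∀ {l : ℝ} {n : ℕ}, 0 < l → l * eigfunConst θ l n ≠ 0 := fun {l n} hl h0 => by
      have := eigfunConst_sq_mul_integral hθ n hl
      rw [h0, zero_mul] at this
      exact zero_ne_one this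
    refine Lp.eq_zero_iff_ae_eq_zero.2 (ae_eq_zero_of_forall_integral_eigfun hθ ha (Lp.memLp f)
      (fun n => ?_) (fun n => ?_))
    · have h1 := (integral_eigfunRight_smul hθ ha n f).symm.trans (hf0 (Sum.inl n))
      exact (smul_eq_zero.1 h1).resolve_left (hc (sub_pos.2 ha.2))
    · have h1 := (integral_eigfunLeft_smul hθ ha n f).symm.trans (hf0 (Sum.inr n))
      exact (smul_eq_zero.1 h1).resolve_left (hc ha.1)
  refine ⟨HilbertBasis.mkOfOrthogonalEqBot horth hbot, fun i => ?_⟩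
  rw [HilbertBasis.coe_mkOfOrthogonalEqBot]
  exact hv i

end Main

theorem mainTheorem5 {𝕜 : Type*} [RCLike 𝕜] (a θ : ℝ) (ha : a ∈ Set.Ioo (0 : ℝ) 1)
    (hθ : θ ∈ Set.Ico (1 : ℝ) 2) :
    -- the positive zeros of the Bessel function form a strictly increasing sequence
    (StrictMono (besselZero (degOrder θ)) ∧
      Set.range (besselZero (degOrder θ)) = {z : ℝ | 0 < z ∧ besselJ (degOrder θ) z = 0}) ∧
    -- the eigenvalues
    {μ : 𝕜 | ∃ φ : ℝ → 𝕜, IsEigenpair a θ μ φ} =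
      Set.range (fun n : ℕ => ((eigvalRight a θ n : ℝ) : 𝕜)) ∪
        Set.range (fun n : ℕ => ((eigvalLeft a θ n : ℝ) : 𝕜)) ∧
    -- the eigenfunctions
    (∀ n : ℕ, IsEigenpair a θ ((eigvalRight a θ n : ℝ) : 𝕜)
      (fun x => ((eigfunRight a θ n x : ℝ) : 𝕜))) ∧
    (∀ n : ℕ, IsEigenpair a θ ((eigvalLeft a θ n : ℝ) : 𝕜)
      (fun x => ((eigfunLeft a θ n x : ℝ) : 𝕜))) ∧
    -- together they form an orthonormal basis of the space of square integrable functions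
    ∃ b : HilbertBasis (ℕ ⊕ ℕ) 𝕜 (MeasureTheory.Lp 𝕜 2 unitMeasure),
      (∀ n : ℕ, (b (Sum.inl n) : ℝ → 𝕜) =ᵐ[unitMeasure]
        fun x => ((eigfunRight a θ n x : ℝ) : 𝕜)) ∧
      (∀ n : ℕ, (b (Sum.inr n) : ℝ → 𝕜) =ᵐ[unitMeasure]
        fun x => ((eigfunLeft a θ n x : ℝ) : 𝕜)) := by
  refine ⟨⟨strictMono_besselZero hθ, range_besselZero hθ⟩, ?_,
    isEigenpair_eigfunRight hθ ha, isEigenpair_eigfunLeft hθ ha, ?_⟩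
  · refine Subset.antisymm (fun μ ⟨φ, h⟩ => h.mem_range hθ ha) ?_
    rintro μ (⟨n, rfl⟩ | ⟨n, rfl⟩)
    · exact ⟨_, isEigenpair_eigfunRight hθ ha n⟩
    · exact ⟨_, isEigenpair_eigfunLeft hθ ha n⟩
  · obtain ⟨b, hb⟩ := exists_hilbertBasis_eigfun (𝕜 := 𝕜) hθ ha
    exact ⟨b, fun n => hb (Sum.inl n), fun n => hb (Sum.inr n)⟩
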